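/- For a finite set $P$ of points in the Euclidean plane, a spanning tree of $P$ is a tree with vertex set $P$; its edges have their Euclidean lengths. A degree-$K$ spanning tree is a spanning tree of maximum degree at most $K$. A minimum spanning tree (MST) minimizes the total edge-length. A bottleneck spanning tree (BST) minimizes the largest edge-length among all spanning trees, and a bottleneck degree-$K$ spanning tree minimizes it among all degree-$K$ spanning trees. The largest edge-length of a one-vertex tree is $0$. Let $\beta_K$ be the supremum, over all finite sets of at least two points in the plane, of the ratio of the largest edge-length of a bottleneck degree-$K$ spanning tree to the largest edge-length of a BST. Then: 1. Every nonempty finite point set in the plane has a spanning tree of maximum degree at most $4$ whose largest edge-length is at most $\sqrt2$ times the largest edge-length of its BST. 2. Consequently $\beta_4\le\sqrt2$. 3. Let $\mathcal T$ be an MST, of maximum degree at most $5$, of a finite point set $P$ in the plane, let $r$ be a leaf of $\mathcal T$ and $v$ the only neighbour of $r$ in $\mathcal T$. Then $P$ has a spanning tree of maximum degree at most $4$ in which $r$ has degree $1$ and $v$ has degree at most $3$, and whose largest edge-length is at most $\sqrt2$ times the largest edge-length of $\mathcal T$. 4. Given $n$ distinct points in the plane and an MST of them of maximum degree at most $5$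 (given as a list of its edges, in any order; such an MST is also a BST), a spanning tree as in 1 can be computed in $O(n)$ time. That is, there are a constant $C$ and a single program on the real RAM (unit-cost addition, subtraction and comparison of natural numbers, unit-cost addition, subtraction, multiplication and comparison of exact real numbers, unit-cost access to arrays) that, on every such input, halts after at most $Cn$ steps and outputs the list of edges of a spanning tree of maximum degree at most $4$ whose largest edge-length is at most $\sqrt2$ times that of the BST. -/

import Mathlib

/-! ### Spanning trees of a finite set of points in the Euclidean plane -/

namespace GeomTree

/-- The Euclidean plane. -/
abbrev Plane : Type := EuclideanSpace ℝ (Fin 2)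

section Trees

variable {V : Type*} [Fintype V]

/-- The length of the segment between the two points of an unordered pair of indices. -/
noncomputable def edgeLength (p : V → Plane) (e : Sym2 V) : ℝ :=
  Sym2.lift ⟨fun u v => dist (p u) (p v), fun u v => dist_comm (p u) (p v)⟩ e

/-- The largest edge-length of a graph drawn on the points `p`
(a graph without edges, as on a one-point set, has largest edge-length `0`). -/
noncomputable def longestEdge (p : V → Plane) (G : SimpleGraph V) : ℝ :=
  sSup (edgeLength p '' G.edgeSet)

open Classical in
/-- The total edge-length of a graph drawn on the points `p`. -/
noncomputable def weight (p : V → Plane) (G : SimpleGraph V) : ℝ :=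
  ∑ e ∈ G.edgeFinset, edgeLength p e

/-- The degree of the vertex `v` in `G`. -/
noncomputable def deg (G : SimpleGraph V) (v : V) : ℕ := (G.neighborSet v).ncard

/-- `T` is a degree-`K` spanning tree: a tree on all the vertices, of maximum degree at most `K`. -/
def IsDegreeTree (K : ℕ) (T : SimpleGraph V) : Prop :=
  T.IsTree ∧ ∀ v, deg T v ≤ K

/-- `T` is a minimum spanning tree of the points `p`: its total edge-length is minimum. -/
def IsMST (p : V → Plane) (T : SimpleGraph V) : Prop :=
  T.IsTree ∧ ∀ T' : SimpleGraph V, T'.IsTree → weight p T ≤ weight p T'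

/-- `T` is a bottleneck spanning tree of the points `p`: its largest edge-length is minimum. -/
def IsBST (p : V → Plane) (T : SimpleGraph V) : Prop :=
  T.IsTree ∧ ∀ T' : SimpleGraph V, T'.IsTree → longestEdge p T ≤ longestEdge p T'

/-- `T` is a bottleneck degree-`K` spanning tree of the points `p`: a degree-`K` spanning tree
whose largest edge-length is minimum among the degree-`K` spanning trees. -/
def IsDegreeBST (K : ℕ) (p : V → Plane) (T : SimpleGraph V) : Prop :=
  IsDegreeTree K T ∧
    ∀ T' : SimpleGraph V, IsDegreeTree K T' → longestEdge p T ≤ longestEdge p T'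

end Trees

/-- The vertices of the finite point set `P`, as points of the plane. -/
def points (P : Finset Plane) : P → Plane := fun x => x.1

/-- `β_K`: the supremum, over all finite sets of at least two points in the plane, of the ratio of
the largest edge-length of the bottleneck degree-`K` spanning tree to the largest edge-length of
the bottleneck spanning tree.  The supremum is taken in `[0, ∞]`. -/
noncomputable def beta (K : ℕ) : ENNReal :=
  ⨆ (P : Finset Plane) (_ : 2 ≤ P.card)
    (D : SimpleGraph P) (_ : IsDegreeBST K (points P) D)
    (B : SimpleGraph P) (_ : IsBST (points P) B),
    ENNReal.ofReal (longestEdge (points P) D / longestEdge (points P) B)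

end GeomTree

/-! ### A real RAM with a step count

Structured programs over natural-number variables, arrays of natural numbers and arrays of real
numbers.  Every variable or array access, every arithmetic operation, every comparison, every
boolean connective, every assignment and every branching takes one step.  Real numbers are handled
exactly, can only be added, subtracted, multiplied and compared, and cannot be converted to
natural numbers. -/

namespace RealRAM

/-- The memory: variables and arrays are named by natural numbers
(a program, being a finite expression, mentions finitely many of them). -/
structure Store where
  /-- the variables -/
  var : ℕ → ℕ
  /-- the arrays of natural numbers: `nat a i` is cell `i` of array `a` -/
  nat : ℕ → ℕ → ℕ
  /-- the arrays of real numbers: `real a i` is cell `i` of array `a` -/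
  real : ℕ → ℕ → ℝ

/-- Expressions for natural numbers; `get a e` reads cell `e` of the array `a`,
`sub` is truncated subtraction. -/
inductive NExpr where
  | lit (c : ℕ)
  | var (x : ℕ)
  | get (a : ℕ) (e : NExpr)
  | add (e f : NExpr)
  | sub (e f : NExpr)

/-- Expressions for real numbers. -/
inductive RExpr where
  | lit (c : ℤ)
  | get (a : ℕ) (e : NExpr)
  | add (e f : RExpr)
  | sub (e f : RExpr)
  | mul (e f : RExpr)

/-- Tests. -/
inductive BExpr where
  | eqN (e f : NExpr)
  | ltN (e f : NExpr)
  | leR (e f : RExpr)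
  | not (b : BExpr)
  | and (b c : BExpr)
  | or (b c : BExpr)

/-- Programs. -/
inductive Cmd where
  | skip
  | setVar (x : ℕ) (e : NExpr)
  | setNat (a : ℕ) (i e : NExpr)
  | setReal (a : ℕ) (i : NExpr) (e : RExpr)
  | seq (c d : Cmd)
  | branch (b : BExpr) (c d : Cmd)
  | loop (b : BExpr) (c : Cmd)

/-- The value of an expression. -/
def NExpr.eval (s : Store) : NExpr → ℕ
  | lit c => c
  | var x => s.var x
  | get a e => s.nat a (e.eval s)
  | add e f => e.eval s + f.eval s
  | sub e f => e.eval s - f.eval s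

/-- The number of steps for evaluating an expression. -/
def NExpr.cost : NExpr → ℕ
  | lit _ => 1
  | var _ => 1
  | get _ e => e.cost + 1
  | add e f => e.cost + f.cost + 1
  | sub e f => e.cost + f.cost + 1

/-- The value of a real expression. -/
noncomputable def RExpr.eval (s : Store) : RExpr → ℝ
  | lit c => (c : ℝ)
  | get a e => s.real a (e.eval s)
  | add e f => e.eval s + f.eval s
  | sub e f => e.eval s - f.eval s
  | mul e f => e.eval s * f.eval s

/-- The number of steps for evaluating a real expression. -/
def RExpr.cost : RExpr → ℕ
  | lit _ => 1
  | get _ e => e.cost + 1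
  | add e f => e.cost + f.cost + 1
  | sub e f => e.cost + f.cost + 1
  | mul e f => e.cost + f.cost + 1

/-- The truth of a test. -/
def BExpr.Holds (s : Store) : BExpr → Prop
  | eqN e f => e.eval s = f.eval s
  | ltN e f => e.eval s < f.eval s
  | leR e f => e.eval s ≤ f.eval s
  | not b => ¬ b.Holds s
  | and b c => b.Holds s ∧ c.Holds s
  | or b c => b.Holds s ∨ c.Holds s

/-- The number of steps for deciding a test. -/
def BExpr.cost : BExpr → ℕ
  | eqN e f => e.cost + f.cost + 1
  | ltN e f => e.cost + f.cost + 1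
  | leR e f => e.cost + f.cost + 1
  | not b => b.cost + 1
  | and b c => b.cost + c.cost + 1
  | or b c => b.cost + c.cost + 1

/-- Assignment to a variable. -/
def Store.updVar (s : Store) (x v : ℕ) : Store :=
  { s with var := Function.update s.var x v }

/-- Assignment to a cell of an array of natural numbers. -/
def Store.updNat (s : Store) (a i v : ℕ) : Store :=
  { s with nat := Function.update s.nat a (Function.update (s.nat a) i v) }

/-- Assignment to a cell of an array of real numbers. -/
noncomputable def Store.updReal (s : Store) (a i : ℕ) (v : ℝ) : Store :=
  { s with real := Function.update s.real a (Function.update (s.real a) i v) }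

/-- `Exec c s s' t`: started in the memory `s`, the program `c` halts after exactly `t` steps,
in the memory `s'`. -/
inductive Exec : Cmd → Store → Store → ℕ → Prop where
  | skip (s : Store) : Exec .skip s s 1
  | setVar (s : Store) (x : ℕ) (e : NExpr) :
      Exec (.setVar x e) s (s.updVar x (e.eval s)) (e.cost + 1)
  | setNat (s : Store) (a : ℕ) (i e : NExpr) :
      Exec (.setNat a i e) s (s.updNat a (i.eval s) (e.eval s)) (i.cost + e.cost + 1)
  | setReal (s : Store) (a : ℕ) (i : NExpr) (e : RExpr) :
      Exec (.setReal a i e) s (s.updReal a (i.eval s) (e.eval s)) (i.cost + e.cost + 1)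
  | seq {c d : Cmd} {s s' s'' : Store} {t u : ℕ} (hc : Exec c s s' t) (hd : Exec d s' s'' u) :
      Exec (.seq c d) s s'' (t + u)
  | branchTrue {b : BExpr} {c d : Cmd} {s s' : Store} {t : ℕ} (hb : b.Holds s)
      (hc : Exec c s s' t) : Exec (.branch b c d) s s' (b.cost + t + 1)
  | branchFalse {b : BExpr} {c d : Cmd} {s s' : Store} {t : ℕ} (hb : ¬ b.Holds s)
      (hd : Exec d s s' t) : Exec (.branch b c d) s s' (b.cost + t + 1)
  | loopTrue {b : BExpr} {c : Cmd} {s s' s'' : Store} {t u : ℕ} (hb : b.Holds s)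
      (hc : Exec c s s' t) (hl : Exec (.loop b c) s' s'' u) :
      Exec (.loop b c) s s'' (b.cost + t + u + 1)
  | loopFalse {b : BExpr} {c : Cmd} {s : Store} (hb : ¬ b.Holds s) :
      Exec (.loop b c) s s (b.cost + 1)

/-- `l` lists every edge of `G` exactly once, in any order and with its two ends in any order. -/
def IsEdgeList {n : ℕ} (G : SimpleGraph (Fin n)) (l : List (Fin n × Fin n)) : Prop :=
  (l.map fun e => s(e.1, e.2)).Nodup ∧
    ∀ e : Sym2 (Fin n), e ∈ l.map (fun e => s(e.1, e.2)) ↔ e ∈ G.edgeSet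

/-- The initial memory on the points `p 0, …, p (n - 1)` and the list of edges `l`: variable `0`
holds `n`, the real arrays `0` and `1` hold the coordinates of the points, and the arrays
`0` and `1` of natural numbers hold the first and the second ends of the listed edges.
All other memory is `0`. -/
noncomputable def inputStore {n : ℕ} (p : Fin n → GeomTree.Plane) (l : List (Fin n × Fin n)) :
    Store where
  var x := if x = 0 then n else 0
  nat a j :=
    if h : j < l.length then
      if a = 0 then (l[j].1 : ℕ) else if a = 1 then (l[j].2 : ℕ) else 0
    else 0
  real a i :=
    if h : i < n then
      if a = 0 then p ⟨i, h⟩ 0 else if a = 1 then p ⟨i, h⟩ 1 else 0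
    else 0

/-- The output convention: the arrays `2` and `3` of natural numbers hold the first and the second
ends of the edges of `G`, each edge once, in consecutive cells starting from cell `0`. -/
def Outputs {n : ℕ} (s : Store) (G : SimpleGraph (Fin n)) : Prop :=
  ∃ l : List (Fin n × Fin n), IsEdgeList G l ∧
    ∀ (j : ℕ) (hj : j < l.length), s.nat 2 j = (l[j].1 : ℕ) ∧ s.nat 3 j = (l[j].2 : ℕ)

end RealRAM

set_option linter.unusedSectionVars false

/-! If two edges `va`, `vb` of length at most `L` meet at a non-obtuse angle, then `|ab| ≤ √2 L`,
and replacing `va` by `ab` frees `v` of one edge. Four vectors of the plane are never pairwise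
obtuse (`not_pairwise_obtuse`), so a vertex of degree 4 has such a pair of neighbours. At a vertex
of degree 5, minimality makes the third side of each triangle at least as long as the other two,
which excludes three pairwise non-obtuse edges (`not_three_acute`), and two disjoint pairs exist
(`exists_two_disjoint_pairs`).

Root the tree at a leaf and form these pairs at every vertex. Each vertex keeps at most three edges
through its own pairs and, the pairs at its parent being disjoint, receives at most one more from
there (`deg_newTree_le`, `extraNeighbors_subsingleton`). A tree edge is moved at most once: when a
vertex has been hung on a sibling, the pair at that vertex containing its parent produces no edge
(`newEnds`). So the factor `√2` never compounds. The result is connected with at most `n - 1` edges,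
hence a tree. Nothing is paired at the root, so its child has degree at most 3.

The existence and `β₄` statements also need a minimum spanning tree of degree at most 5. Among the
minimum spanning trees, take one with least sum of squared horizontal extents. Six neighbours of a
vertex would contain half a regular hexagon, whose edges can be exchanged at equal length; the
tie-break then forces three directions 60° apart to have equal horizontal extents, which is
impossible (`exists_isMST_deg_le_five`). A minimum spanning tree is also a bottleneck tree, which
gives the comparison.

The pairings at different vertices are independent and each needs boundedly many sign tests of inner
products. With parents from a breadth-first search this takes linear time; the program is verified
by loop invariants. -/

/-! ### Exchanging one edge of a tree -/

theorem SimpleGraph.reachable_deleteEdge_or {V : Type*} {T : SimpleGraph V} {v a : V}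
    (hT : T.Connected) (z : V) :
    (T.deleteEdges {s(v, a)}).Reachable z v ∨ (T.deleteEdges {s(v, a)}).Reachable z a := by
  obtain ⟨w⟩ := hT.preconnected z v
  suffices H : ∀ x, T.Walk z x → x = v →
      (T.deleteEdges {s(v, a)}).Reachable z v ∨ (T.deleteEdges {s(v, a)}).Reachable z a from
    H v w rfl
  clear w
  intro x w hx
  induction w with
  | nil => subst hx; exact Or.inl (SimpleGraph.Reachable.refl _)
  | @cons z y _ h w ih =>
    by_cases he : s(z, y) = s(v, a)
    · rcases Sym2.eq_iff.1 he with ⟨rfl, rfl⟩ | ⟨rfl, rfl⟩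
      · exact Or.inl (SimpleGraph.Reachable.refl _)
      · exact Or.inr (SimpleGraph.Reachable.refl _)
    · have hadj : (T.deleteEdges {s(v, a)}).Adj z y := by
        rw [SimpleGraph.deleteEdges_adj]; exact ⟨h, he⟩
      exact (ih hx).imp hadj.reachable.trans hadj.reachable.trans

/-- Deleting an edge leaves at most two components, one at each end of it. An edge between
unreachable vertices therefore joins them again and closes no cycle. -/
theorem SimpleGraph.IsTree.exchange {V : Type*} {T : SimpleGraph V} (hT : T.IsTree) {v a x y : V}
    (hxy : ¬ (T.deleteEdges {s(v, a)}).Reachable x y) :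
    (T.deleteEdges {s(v, a)} ⊔ SimpleGraph.edge x y).IsTree := by
  set D := T.deleteEdges {s(v, a)} with hD
  have hne : x ≠ y := fun h => hxy (h ▸ SimpleGraph.Reachable.refl _)
  have hle : D ≤ D ⊔ SimpleGraph.edge x y := le_sup_left
  refine ⟨?_, (hT.isAcyclic.anti (SimpleGraph.deleteEdges_le _)).sup_edge_of_not_reachable hxy⟩
  have hadj : (D ⊔ SimpleGraph.edge x y).Adj x y := by
    simp [SimpleGraph.edge_adj, hne]
  have key : (D ⊔ SimpleGraph.edge x y).Reachable v a := by
    rcases SimpleGraph.reachable_deleteEdge_or hT.connected (v := v) (a := a) x with hx | hx <;>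
    rcases SimpleGraph.reachable_deleteEdge_or hT.connected (v := v) (a := a) y with hy | hy
    · exact absurd (hx.trans hy.symm) hxy
    · exact ((hx.mono hle).symm.trans hadj.reachable).trans (hy.mono hle)
    · exact ((hy.mono hle).symm.trans hadj.reachable.symm).trans (hx.mono hle)
    · exact absurd (hx.trans hy.symm) hxy
  have all : ∀ z, (D ⊔ SimpleGraph.edge x y).Reachable z v := fun z => by
    rcases SimpleGraph.reachable_deleteEdge_or hT.connected (v := v) (a := a) z with h | h
    · exact h.mono hle
    · exact (h.mono hle).trans key.symm
  exact (SimpleGraph.connected_iff _).2 ⟨fun z w => (all z).trans (all w).symm, hT.connected.nonempty⟩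

open Classical in
/-- The sum of `f` over the edges of `G`. -/
noncomputable def SimpleGraph.edgeSum {V : Type*} [Fintype V] (f : Sym2 V → ℝ)
    (G : SimpleGraph V) : ℝ :=
  ∑ e ∈ G.edgeFinset, f e

/-- The function `f` is arbitrary because lengths decide minimality and squared horizontal extents
break ties. -/
theorem SimpleGraph.edgeSum_exchange {V : Type*} [Fintype V] {T : SimpleGraph V}
    {v a x y : V} (hva : T.Adj v a) (hxy : ¬ (T.deleteEdges {s(v, a)}).Reachable x y)
    (f : Sym2 V → ℝ) :
    (T.deleteEdges {s(v, a)} ⊔ SimpleGraph.edge x y).edgeSum f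
      = T.edgeSum f - f s(v, a) + f s(x, y) := by
  classical
  have hne : x ≠ y := fun h => hxy (h ▸ SimpleGraph.Reachable.refl _)
  have h1 : (T.deleteEdges {s(v, a)} ⊔ SimpleGraph.edge x y).edgeFinset
      = insert s(x, y) (T.edgeFinset.erase s(v, a)) := by
    ext e
    induction e with | h b c =>
    simp only [SimpleGraph.mem_edgeFinset, SimpleGraph.mem_edgeSet, SimpleGraph.sup_adj,
      SimpleGraph.deleteEdges_adj, SimpleGraph.edge_adj, Set.mem_singleton_iff, Finset.mem_insert,
      Finset.mem_erase, Sym2.eq_iff]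
    grind
  have h2 : s(x, y) ∉ T.edgeFinset.erase s(v, a) := by
    intro h
    rw [Finset.mem_erase, SimpleGraph.mem_edgeFinset, SimpleGraph.mem_edgeSet] at h
    exact hxy (SimpleGraph.Adj.reachable (by rw [SimpleGraph.deleteEdges_adj]; exact ⟨h.2, h.1⟩))
  have h3 : (T.deleteEdges {s(v, a)} ⊔ SimpleGraph.edge x y).edgeSum f
      = ∑ e ∈ insert s(x, y) (T.edgeFinset.erase s(v, a)), f e := by
    rw [← h1]; unfold SimpleGraph.edgeSum; congr!
  have h4 : T.edgeSum f = ∑ e ∈ T.edgeFinset, f e := by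
    unfold SimpleGraph.edgeSum; congr!
  rw [h3, h4, Finset.sum_insert h2, Finset.sum_erase_eq_sub (by simpa using hva)]
  ring

theorem SimpleGraph.IsTree.not_reachable_deleteEdge {V : Type*} {T : SimpleGraph V}
    (hT : T.IsTree) {v a : V} (hva : T.Adj v a) :
    ¬ (T.deleteEdges {s(v, a)}).Reachable v a :=
  (SimpleGraph.isBridge_iff.1 ((SimpleGraph.isAcyclic_iff_forall_adj_isBridge.1 hT.isAcyclic) hva))

/-- The edge `vb` survives the deletion, so a connection from `a` to `b` would reconnect `v` and `a`
across a bridge. -/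
theorem SimpleGraph.IsTree.not_reachable_deleteEdge_of_adj {V : Type*} {T : SimpleGraph V}
    (hT : T.IsTree) {v a b : V} (hva : T.Adj v a) (hvb : T.Adj v b) (hab : a ≠ b) :
    ¬ (T.deleteEdges {s(v, a)}).Reachable a b := by
  intro h
  have : (T.deleteEdges {s(v, a)}).Adj v b := by
    rw [SimpleGraph.deleteEdges_adj]
    refine ⟨hvb, ?_⟩
    simp only [Set.mem_singleton_iff, Sym2.eq_iff]
    rintro (⟨-, h⟩ | ⟨h, -⟩)
    · exact hab h.symm
    · exact hva.ne h
  exact hT.not_reachable_deleteEdge hva (this.reachable.trans h.symm)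

/-! ### Cut property of minimum spanning trees -/

namespace GeomTree

theorem edgeLength_mk {V : Type*} [Fintype V] (p : V → Plane) (u v : V) :
    edgeLength p s(u, v) = dist (p u) (p v) := rfl

theorem weight_eq_edgeSum {V : Type*} [Fintype V] (p : V → Plane) (G : SimpleGraph V) :
    weight p G = G.edgeSum (edgeLength p) := rfl

section MST

variable {V : Type*} [Fintype V] {p : V → Plane} {T : SimpleGraph V}

theorem edgeLength_le_longestEdge (p : V → Plane) {u v : V} (h : T.Adj u v) :
    dist (p u) (p v) ≤ longestEdge p T :=
  le_csSup ((Set.toFinite T.edgeSet).image (edgeLength p)).bddAbove ⟨s(u, v), h, rfl⟩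

theorem longestEdge_nonneg (p : V → Plane) (T : SimpleGraph V) : 0 ≤ longestEdge p T := by
  apply Real.sSup_nonneg
  rintro _ ⟨e, -, rfl⟩
  induction e with | h a b => exact dist_nonneg (x := p a) (y := p b)

theorem longestEdge_le {c : ℝ} (hc : 0 ≤ c) (h : ∀ u v, T.Adj u v → dist (p u) (p v) ≤ c) :
    longestEdge p T ≤ c := by
  apply Real.sSup_le _ hc
  rintro _ ⟨e, he, rfl⟩
  induction e with | h a b => exact h a b he

theorem IsMST.dist_le_of_not_reachable (hT : IsMST p T) {v a x y : V} (hva : T.Adj v a)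
    (hxy : ¬ (T.deleteEdges {s(v, a)}).Reachable x y) : dist (p v) (p a) ≤ dist (p x) (p y) := by
  have h := hT.2 _ (hT.1.exchange hxy)
  rw [weight_eq_edgeSum, weight_eq_edgeSum, SimpleGraph.edgeSum_exchange hva hxy, edgeLength_mk,
    edgeLength_mk] at h
  linarith

/-- A minimum spanning tree is a bottleneck spanning tree. -/
theorem IsMST.longestEdge_le (hT : IsMST p T) {B : SimpleGraph V} (hB : B.Connected) :
    longestEdge p T ≤ longestEdge p B := by
  refine GeomTree.longestEdge_le (longestEdge_nonneg _ _) fun v a hva => ?_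
  -- A walk in `B` from `v` to `a` must cross the cut left by deleting `va`; the crossing edge is at
  -- least as long as `va`.
  obtain ⟨x, y, hxy, hr⟩ : ∃ x y, B.Adj x y ∧ ¬ (T.deleteEdges {s(v, a)}).Reachable x y := by
    by_contra! hcon
    suffices H : ∀ x y, B.Walk x y → (T.deleteEdges {s(v, a)}).Reachable x y by
      obtain ⟨w⟩ := hB.preconnected v a
      exact hT.1.not_reachable_deleteEdge hva (H v a w)
    intro x y w
    induction w with
    | nil => exact SimpleGraph.Reachable.refl _
    | cons h w ih => exact (hcon _ _ h).trans ih
  exact (hT.dist_le_of_not_reachable hva hr).trans (edgeLength_le_longestEdge p hxy)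

theorem IsMST.dist_le_dist (hT : IsMST p T) {v a b : V} (hva : T.Adj v a) (hvb : T.Adj v b)
    (hab : a ≠ b) : dist (p v) (p a) ≤ dist (p a) (p b) :=
  hT.dist_le_of_not_reachable hva (hT.1.not_reachable_deleteEdge_of_adj hva hvb hab)

/-- This is `|va| ≤ |ab|` squared, with `|p a - p v|²` cancelled. -/
theorem IsMST.two_inner_le (hT : IsMST p T) {v a b : V} (hva : T.Adj v a) (hvb : T.Adj v b)
    (hab : a ≠ b) : 2 * inner ℝ (p a - p v) (p b - p v) ≤ ‖p b - p v‖ ^ 2 := by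
  have h := hT.dist_le_dist hva hvb hab
  have h2 : dist (p a) (p b) = ‖(p a - p v) - (p b - p v)‖ := by
    rw [dist_eq_norm]; congr 1; abel
  rw [h2, dist_comm, dist_eq_norm] at h
  generalize p a - p v = x at *
  generalize p b - p v = y at *
  have h3 := pow_le_pow_left₀ (norm_nonneg _) h 2
  rw [@norm_sub_sq_real] at h3
  linarith

end MST
end GeomTree

/-! ### Angles between vectors of the plane -/

namespace GeomTree

/-- The determinant of two vectors of the plane. -/
def cross (a b : Plane) : ℝ := a 0 * b 1 - a 1 * b 0

theorem inner_plane (a b : Plane) : inner ℝ a b = a 0 * b 0 + a 1 * b 1 := by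
  simp [PiLp.inner_apply, Fin.sum_univ_two, mul_comm]

/-- Up to the factor `|u|`, `inner u` and `cross u` are the coordinates along and across `u`; this
is the inner product in that frame. -/
theorem inner_mul_inner_add_cross_mul_cross (u a b : Plane) :
    inner ℝ u a * inner ℝ u b + cross u a * cross u b = inner ℝ u u * inner ℝ a b := by
  simp only [inner_plane, cross]; ring

theorem inner_sq_add_cross_sq (u a : Plane) :
    inner ℝ u a ^ 2 + cross u a ^ 2 = inner ℝ u u * inner ℝ a a := by
  simp only [inner_plane, cross]; ring

/-- Four vectors of the plane are not pairwise at obtuse angles. -/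
theorem not_pairwise_obtuse {a b c d : Plane} (hab : inner ℝ a b < 0) (hac : inner ℝ a c < 0)
    (had : inner ℝ a d < 0) (hbc : inner ℝ b c < 0) (hbd : inner ℝ b d < 0)
    (hcd : inner ℝ c d < 0) : False := by
  -- Two vectors obtuse to `a` and to each other lie strictly on opposite sides of the line of `a`.
  -- Three vectors cannot do so pairwise.
  have key : ∀ x y : Plane, inner ℝ a x < 0 → inner ℝ a y < 0 → inner ℝ x y < 0 →
      cross a x * cross a y < 0 := by
    intro x y hx hy hxy
    have h := inner_mul_inner_add_cross_mul_cross a x y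
    have h1 := mul_pos_of_neg_of_neg hx hy
    have h2 : (0 : ℝ) ≤ inner ℝ a a := real_inner_self_nonneg
    nlinarith
  have h1 := key b c hab hac hbc
  have h2 := key b d hab had hbd
  have h3 := key c d hac had hcd
  have h4 := mul_pos_of_neg_of_neg h1 h2
  nlinarith [sq_nonneg (cross a b)]

/-- Three nonzero vectors of the plane are not pairwise at angles between 60° and 90°. -/
theorem not_three_acute {a b c : Plane} (ha : a ≠ 0) (hb : b ≠ 0) (hc : c ≠ 0)
    (hab : 0 ≤ inner ℝ a b) (hbc : 0 ≤ inner ℝ b c) (hac : 0 ≤ inner ℝ a c)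
    (hab1 : 2 * inner ℝ a b ≤ ‖a‖ ^ 2) (hab2 : 2 * inner ℝ a b ≤ ‖b‖ ^ 2)
    (hbc1 : 2 * inner ℝ b c ≤ ‖b‖ ^ 2) (hbc2 : 2 * inner ℝ b c ≤ ‖c‖ ^ 2)
    (hac1 : 2 * inner ℝ a c ≤ ‖a‖ ^ 2) (hac2 : 2 * inner ℝ a c ≤ ‖c‖ ^ 2) : False := by
  -- The Gram determinant of three vectors of a plane vanishes. The spread bounds make its negative
  -- terms at most three quarters of the positive product `‖a‖²‖b‖²‖c‖²`.
  have gram : ‖a‖ ^ 2 * ‖b‖ ^ 2 * ‖c‖ ^ 2 + 2 * (inner ℝ a b * inner ℝ b c * inner ℝ a c)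
      - ‖a‖ ^ 2 * inner ℝ b c ^ 2 - ‖b‖ ^ 2 * inner ℝ a c ^ 2 - ‖c‖ ^ 2 * inner ℝ a b ^ 2 = 0 := by
    simp only [← real_inner_self_eq_norm_sq, inner_plane]; ring
  have pa : 0 < ‖a‖ ^ 2 := by positivity
  have pb : 0 < ‖b‖ ^ 2 := by positivity
  have pc : 0 < ‖c‖ ^ 2 := by positivity
  generalize ‖a‖ ^ 2 = A at *
  generalize ‖b‖ ^ 2 = B at *
  generalize ‖c‖ ^ 2 = C at *
  generalize inner ℝ a b = x at *
  generalize inner ℝ b c = y at *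
  generalize inner ℝ a c = z at *
  have h1 : (2 * x) * (2 * x) ≤ A * B := mul_le_mul hab1 hab2 (by linarith) pa.le
  have h2 : (2 * y) * (2 * y) ≤ B * C := mul_le_mul hbc1 hbc2 (by linarith) pb.le
  have h3 : (2 * z) * (2 * z) ≤ A * C := mul_le_mul hac1 hac2 (by linarith) pa.le
  have h4 := mul_le_mul_of_nonneg_left h1 pc.le
  have h5 := mul_le_mul_of_nonneg_left h2 pa.le
  have h6 := mul_le_mul_of_nonneg_left h3 pb.le
  have h7 : 0 < A * B * C := by positivity
  have h8 : 0 ≤ x * y * z := by positivity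
  nlinarith

/-- The condition on two edges `a`, `b` with a common end in a minimum spanning tree:
the third side of their triangle is not shorter than they are. -/
def Spread (a b : Plane) : Prop := 2 * inner ℝ a b ≤ ‖a‖ ^ 2 ∧ 2 * inner ℝ a b ≤ ‖b‖ ^ 2

/-- Among five pairwise spread vectors there are two disjoint pairs at non-obtuse angles. -/
theorem exists_two_disjoint_pairs {w : Fin 5 → Plane} (h0 : ∀ i, w i ≠ 0)
    (hs : ∀ i j, i ≠ j → Spread (w i) (w j)) :
    ∃ i j k l : Fin 5, [i, j, k, l].Nodup ∧ 0 ≤ inner ℝ (w i) (w j) ∧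
      0 ≤ inner ℝ (w k) (w l) := by
  -- Join two indices when their vectors are non-obtuse. A graph without triangles and without two
  -- disjoint edges is a star; the four vertices other than its centre would be pairwise obtuse. The
  -- instances below reduce this to propositional logic.
  by_contra! hcon
  have four : ∀ i j k l : Fin 5, ¬ 0 ≤ inner ℝ (w i) (w j) → ¬ 0 ≤ inner ℝ (w i) (w k) →
      ¬ 0 ≤ inner ℝ (w i) (w l) → ¬ 0 ≤ inner ℝ (w j) (w k) → ¬ 0 ≤ inner ℝ (w j) (w l) →
      ¬ 0 ≤ inner ℝ (w k) (w l) → False := fun i j k l => by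
    simp only [not_le]; exact not_pairwise_obtuse
  have three : ∀ i j k : Fin 5, i ≠ j → j ≠ k → i ≠ k → 0 ≤ inner ℝ (w i) (w j) →
      0 ≤ inner ℝ (w j) (w k) → 0 ≤ inner ℝ (w i) (w k) → False := fun i j k hij hjk hik a b c =>
    not_three_acute (h0 i) (h0 j) (h0 k) a b c (hs _ _ hij).1 (hs _ _ hij).2
      (hs _ _ hjk).1 (hs _ _ hjk).2 (hs _ _ hik).1 (hs _ _ hik).2
  have disj : ∀ i j k l : Fin 5, [i, j, k, l].Nodup → 0 ≤ inner ℝ (w i) (w j) →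
      ¬ 0 ≤ inner ℝ (w k) (w l) := fun i j k l h h1 => not_le.2 (hcon i j k l h h1)
  have f1 := four 0 1 2 3
  have f2 := four 0 1 2 4
  have f3 := four 0 1 3 4
  have f4 := four 0 2 3 4
  have f5 := four 1 2 3 4
  have t1 := three 0 1 2 (by decide) (by decide) (by decide)
  have t2 := three 0 1 3 (by decide) (by decide) (by decide)
  have t3 := three 0 1 4 (by decide) (by decide) (by decide)
  have t4 := three 0 2 3 (by decide) (by decide) (by decide)
  have t5 := three 0 2 4 (by decide) (by decide) (by decide)
  have t6 := three 0 3 4 (by decide) (by decide) (by decide)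
  have t7 := three 1 2 3 (by decide) (by decide) (by decide)
  have t8 := three 1 2 4 (by decide) (by decide) (by decide)
  have t9 := three 1 3 4 (by decide) (by decide) (by decide)
  have t10 := three 2 3 4 (by decide) (by decide) (by decide)
  have d1 := disj 0 1 2 3 (by decide)
  have d2 := disj 0 1 2 4 (by decide)
  have d3 := disj 0 1 3 4 (by decide)
  have d4 := disj 0 2 1 3 (by decide)
  have d5 := disj 0 2 1 4 (by decide)
  have d6 := disj 0 2 3 4 (by decide)
  have d7 := disj 0 3 1 2 (by decide)
  have d8 := disj 0 3 1 4 (by decide)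
  have d9 := disj 0 3 2 4 (by decide)
  have d10 := disj 0 4 1 2 (by decide)
  have d11 := disj 0 4 1 3 (by decide)
  have d12 := disj 0 4 2 3 (by decide)
  have d13 := disj 1 2 3 4 (by decide)
  have d14 := disj 1 3 2 4 (by decide)
  have d15 := disj 1 4 2 3 (by decide)
  clear four three disj hcon hs h0
  generalize (0 ≤ inner ℝ (w 0) (w 1)) = p01 at *
  generalize (0 ≤ inner ℝ (w 0) (w 2)) = p02 at *
  generalize (0 ≤ inner ℝ (w 0) (w 3)) = p03 at *
  generalize (0 ≤ inner ℝ (w 0) (w 4)) = p04 at *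
  generalize (0 ≤ inner ℝ (w 1) (w 2)) = p12 at *
  generalize (0 ≤ inner ℝ (w 1) (w 3)) = p13 at *
  generalize (0 ≤ inner ℝ (w 1) (w 4)) = p14 at *
  generalize (0 ≤ inner ℝ (w 2) (w 3)) = p23 at *
  generalize (0 ≤ inner ℝ (w 2) (w 4)) = p24 at *
  generalize (0 ≤ inner ℝ (w 3) (w 4)) = p34 at *
  grind +splitImp

theorem exists_pair (w : Fin 4 → Plane) : ∃ i j : Fin 4, i ≠ j ∧ 0 ≤ inner ℝ (w i) (w j) := by
  by_contra! hcon
  exact not_pairwise_obtuse (hcon 0 1 (by decide)) (hcon 0 2 (by decide)) (hcon 0 3 (by decide))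
    (hcon 1 2 (by decide)) (hcon 1 3 (by decide)) (hcon 2 3 (by decide))

/-- The source of the constant: `|a - b|² = |a|² + |b|² - 2⟨a, b⟩ ≤ 2L²`. -/
theorem norm_sub_le_of_inner_nonneg {a b : Plane} {L : ℝ} (h : 0 ≤ inner ℝ a b) (ha : ‖a‖ ≤ L)
    (hb : ‖b‖ ≤ L) : ‖a - b‖ ≤ √2 * L := by
  have hL : 0 ≤ L := (norm_nonneg _).trans ha
  rw [← Real.sqrt_sq hL, ← Real.sqrt_mul zero_le_two]
  apply Real.le_sqrt_of_sq_le
  rw [@norm_sub_sq_real]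
  have h1 := pow_le_pow_left₀ (norm_nonneg _) ha 2
  have h2 := pow_le_pow_left₀ (norm_nonneg _) hb 2
  linarith

/-- Three pairwise spread vectors on one side of a vector `u` from which they are spread
form half a regular hexagon with it. -/
theorem exists_hexagon_of_sorted {u w₁ w₂ w₃ : Plane} (hu : u ≠ 0) (h₁ : w₁ ≠ 0) (h₂ : w₂ ≠ 0)
    (h₃ : w₃ ≠ 0) (c₁₂ : 0 ≤ cross u w₁ * cross u w₂) (c₂₃ : 0 ≤ cross u w₂ * cross u w₃)
    (s₁ : Spread u w₁) (s₁₂ : Spread w₁ w₂) (s₂₃ : Spread w₂ w₃)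
    (le₁₂ : InnerProductGeometry.angle u w₁ ≤ InnerProductGeometry.angle u w₂)
    (le₂₃ : InnerProductGeometry.angle u w₂ ≤ InnerProductGeometry.angle u w₃) :
    w₂ = w₁ - u ∧ w₃ = -u ∧ ‖w₁‖ = ‖u‖ ∧ ‖w₂‖ = ‖u‖ := by
  have inner_eq : ∀ a b : Plane, inner ℝ a b =
      Real.cos (InnerProductGeometry.angle a b) * (‖a‖ * ‖b‖) := fun a b =>
    (InnerProductGeometry.cos_angle_mul_norm_mul_norm a b).symm
  -- A cosine above `1/2` would make each of the two vectors strictly shorter than the other.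
  have spread_cos : ∀ a b : Plane, a ≠ 0 → b ≠ 0 → Spread a b →
      Real.cos (InnerProductGeometry.angle a b) ≤ 1 / 2 := by
    intro a b ha hb hs
    have pa : 0 < ‖a‖ := norm_pos_iff.2 ha
    have pb : 0 < ‖b‖ := norm_pos_iff.2 hb
    have h1 := hs.1
    have h2 := hs.2
    rw [inner_eq] at h1 h2
    by_contra! hc
    have h3 : 0 < ‖a‖ * ‖b‖ := by positivity
    have h4 : ‖a‖ * ‖b‖ < ‖a‖ * ‖a‖ := by nlinarith
    have h5 : ‖a‖ * ‖b‖ < ‖b‖ * ‖b‖ := by nlinarith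
    have h6 := lt_of_mul_lt_mul_left h4 pa.le
    have h7 := lt_of_mul_lt_mul_right h5 pb.le
    exact lt_asymm h6 h7
  -- At exactly 60° the two inequalities read `‖a‖‖b‖ ≤ ‖a‖²` and `‖a‖‖b‖ ≤ ‖b‖²`.
  have spread_eq : ∀ a b : Plane, a ≠ 0 → b ≠ 0 → Spread a b →
      InnerProductGeometry.angle a b = Real.pi / 3 → ‖a‖ = ‖b‖ := by
    intro a b ha hb hs h
    have pa : 0 < ‖a‖ := norm_pos_iff.2 ha
    have pb : 0 < ‖b‖ := norm_pos_iff.2 hb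
    have h1 := hs.1
    have h2 := hs.2
    rw [inner_eq, h, Real.cos_pi_div_three] at h1 h2
    nlinarith
  have pu : 0 < ‖u‖ := norm_pos_iff.2 hu
  have sin_eq : ∀ a : Plane, |cross u a| =
      Real.sin (InnerProductGeometry.angle u a) * (‖u‖ * ‖a‖) := by
    intro a
    rw [InnerProductGeometry.sin_angle_mul_norm_mul_norm, ← Real.sqrt_sq_eq_abs]
    congr 1
    have := inner_sq_add_cross_sq u a
    linarith
  -- On one side of `u` the two cross products have a nonnegative product, so the frame identity
  -- becomes the addition formula for the cosine.
  have sub_cos : ∀ a b : Plane, a ≠ 0 → b ≠ 0 → 0 ≤ cross u a * cross u b →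
      Real.cos (InnerProductGeometry.angle a b) =
        Real.cos (InnerProductGeometry.angle u b - InnerProductGeometry.angle u a) := by
    intro a b ha hb hc
    have pa : 0 < ‖a‖ := norm_pos_iff.2 ha
    have pb : 0 < ‖b‖ := norm_pos_iff.2 hb
    have h1 := inner_mul_inner_add_cross_mul_cross u a b
    rw [← abs_of_nonneg hc, abs_mul, sin_eq, sin_eq, inner_eq u a, inner_eq u b, inner_eq a b,
      real_inner_self_eq_norm_sq] at h1
    rw [Real.cos_sub]
    have h3 : 0 < ‖u‖ ^ 2 * (‖a‖ * ‖b‖) := by positivity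
    apply mul_left_cancel₀ h3.ne'
    linarith
  have sep : ∀ t : ℝ, 0 ≤ t → Real.cos t ≤ 1 / 2 → Real.pi / 3 ≤ t := by
    intro t ht hc
    by_contra! hlt
    have := Real.cos_lt_cos_of_nonneg_of_le_pi ht (by linarith [Real.pi_pos]) hlt
    rw [Real.cos_pi_div_three] at this
    linarith
  -- Three successive gaps of at least `π/3` fit into an angle of at most `π` only with equality
  -- throughout.
  have a1 := sep _ (InnerProductGeometry.angle_nonneg u w₁) (spread_cos _ _ hu h₁ s₁)
  have a2 := sep _ (sub_nonneg.2 le₁₂) (by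
    rw [← sub_cos _ _ h₁ h₂ c₁₂]; exact spread_cos _ _ h₁ h₂ s₁₂)
  have a3 := sep _ (sub_nonneg.2 le₂₃) (by
    rw [← sub_cos _ _ h₂ h₃ c₂₃]; exact spread_cos _ _ h₂ h₃ s₂₃)
  have a4 := InnerProductGeometry.angle_le_pi u w₃
  have e1 : InnerProductGeometry.angle u w₁ = Real.pi / 3 := by linarith
  have e2 : InnerProductGeometry.angle u w₂ = Real.pi - Real.pi / 3 := by linarith
  have e3 : InnerProductGeometry.angle u w₃ = Real.pi := by linarith
  have eq_of_sub : ∀ a b : Plane, a ≠ 0 → b ≠ 0 → 0 ≤ cross u a * cross u b →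
      InnerProductGeometry.angle u b - InnerProductGeometry.angle u a = Real.pi / 3 →
      InnerProductGeometry.angle a b = Real.pi / 3 := by
    intro a b ha hb hc he
    apply Real.injOn_cos ⟨InnerProductGeometry.angle_nonneg _ _, InnerProductGeometry.angle_le_pi _ _⟩
      ⟨by linarith [Real.pi_pos], by linarith [Real.pi_pos]⟩
    rw [sub_cos a b ha hb hc, he]
  have e12 := eq_of_sub _ _ h₁ h₂ c₁₂ (by linarith)
  have e23 := eq_of_sub _ _ h₂ h₃ c₂₃ (by linarith)
  have n1 := spread_eq _ _ hu h₁ s₁ e1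
  have n2 := spread_eq _ _ h₁ h₂ s₁₂ e12
  have n3 := spread_eq _ _ h₂ h₃ s₂₃ e23
  have i1 := inner_eq u w₁
  have i2 := inner_eq u w₂
  have i3 := inner_eq u w₃
  have i12 := inner_eq w₁ w₂
  rw [e1, Real.cos_pi_div_three, ← n1] at i1
  rw [e2, Real.cos_pi_sub, Real.cos_pi_div_three, ← n2, ← n1] at i2
  rw [e3, Real.cos_pi, ← n3, ← n2, ← n1] at i3
  rw [e12, Real.cos_pi_div_three, ← n2, ← n1] at i12
  -- All lengths and inner products are now known, so each vector equation is checked by expanding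
  -- the squared norm of the difference.
  refine ⟨?_, ?_, n1.symm, by rw [← n2, n1]⟩
  · rw [← sub_eq_zero, ← norm_eq_zero, ← sq_eq_zero_iff, @norm_sub_sq_real, @norm_sub_sq_real,
      inner_sub_right, real_inner_comm w₁ w₂, real_inner_comm u w₂, real_inner_comm u w₁,
      i1, i2, i12, ← n2, ← n1]
    ring
  · rw [← sub_eq_zero, sub_neg_eq_add, ← norm_eq_zero, ← sq_eq_zero_iff, @norm_add_sq_real,
      real_inner_comm, i3, ← n3, ← n2, ← n1]
    ring

end GeomTree

/-! ### A minimum spanning tree of maximum degree at most five -/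

namespace GeomTree

/-- Sorting the three vectors by their angle to `u` reduces to the ordered case. -/
theorem exists_hexagon {u : Plane} {w : Fin 3 → Plane} (hu : u ≠ 0) (hw : ∀ i, w i ≠ 0)
    (hc : ∀ i j, 0 ≤ cross u (w i) * cross u (w j)) (hu' : ∀ i, Spread u (w i))
    (hs : ∀ i j, i ≠ j → Spread (w i) (w j)) :
    ∃ i j k, i ≠ j ∧ j ≠ k ∧ i ≠ k ∧ w j = w i - u ∧ w k = -u ∧ ‖w i‖ = ‖u‖ ∧ ‖w j‖ = ‖u‖ := by
  set f : Fin 3 → ℝ := fun i => InnerProductGeometry.angle u (w i)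
  have hm := Tuple.monotone_sort f
  set σ := Tuple.sort f
  have hne : ∀ i j : Fin 3, i ≠ j → σ i ≠ σ j := fun i j h => σ.injective.ne h
  exact ⟨σ 0, σ 1, σ 2, hne _ _ (by decide), hne _ _ (by decide), hne _ _ (by decide),
    exists_hexagon_of_sorted hu (hw _) (hw _) (hw _) (hc _ _) (hc _ _) (hu' _)
      (hs _ _ (hne _ _ (by decide))) (hs _ _ (hne _ _ (by decide)))
      (hm (by decide : (0 : Fin 3) ≤ 1)) (hm (by decide : (1 : Fin 3) ≤ 2))⟩

variable {V : Type*} [Fintype V] {p : V → Plane} {T : SimpleGraph V}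

theorem IsMST.spread (hT : IsMST p T) {v a b : V} (hva : T.Adj v a) (hvb : T.Adj v b)
    (hab : a ≠ b) : Spread (p a - p v) (p b - p v) :=
  ⟨by rw [real_inner_comm]; exact hT.two_inner_le hvb hva hab.symm, hT.two_inner_le hva hvb hab⟩

/-- The square of the horizontal extent of an edge. -/
noncomputable def horizontalSq (p : V → Plane) (e : Sym2 V) : ℝ :=
  Sym2.lift ⟨fun u v => (p u 0 - p v 0) ^ 2, fun u v => by ring⟩ e

theorem horizontalSq_mk (p : V → Plane) (u v : V) :
    horizontalSq p s(u, v) = (p u 0 - p v 0) ^ 2 := rfl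

/-- Here `t² = 2st`, and squaring gives `t⁴ = 4t⁴`. It serves for the coordinates of three
directions 60° apart. -/
theorem eq_zero_of_sq_eq_sq_of_sub_sq_eq_sq {s t : ℝ} (h₁ : s ^ 2 = t ^ 2)
    (h₂ : (s - t) ^ 2 = t ^ 2) : t = 0 := by
  have h3 : t ^ 2 = 2 * s * t := by linarith
  have h4 : (t ^ 2) * (t ^ 2) = 4 * ((t ^ 2) * (t ^ 2)) := by
    calc t ^ 2 * t ^ 2 = (2 * s * t) * (2 * s * t) := by rw [h3]
      _ = 4 * (s ^ 2 * t ^ 2) := by ring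
      _ = 4 * (t ^ 2 * t ^ 2) := by rw [h₁]
  exact pow_eq_zero_iff two_ne_zero |>.1 (mul_self_eq_zero.1 (by linarith))

/-- Minimize total length and then the sum of `g`, lexicographically: an exchange between edges of
equal length cannot lower the sum of `g`. -/
theorem exists_isMST_lex [Nonempty V] (p : V → Plane) (g : Sym2 V → ℝ) :
    ∃ T : SimpleGraph V, IsMST p T ∧ ∀ v a x y, T.Adj v a →
      ¬ (T.deleteEdges {s(v, a)}).Reachable x y → dist (p v) (p a) = dist (p x) (p y) →
      g s(v, a) ≤ g s(x, y) := by
  obtain ⟨T₀, -, hT₀⟩ := (SimpleGraph.connected_top (V := V)).exists_isTree_le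
  obtain ⟨T, hT, hmin⟩ := Set.exists_min_image {T : SimpleGraph V | T.IsTree}
    (fun T => toLex (weight p T, T.edgeSum g)) (Set.toFinite _) ⟨T₀, hT₀⟩
  simp only [Set.mem_ofPred_eq, Prod.Lex.toLex_le_toLex] at hT hmin
  refine ⟨T, ⟨hT, fun T' hT' => ?_⟩, fun v a x y hva hxy hd => ?_⟩
  · rcases hmin T' hT' with h | h
    · exact h.le
    · exact h.1.le
  · have h := hmin _ (hT.exchange hxy)
    rw [weight_eq_edgeSum, weight_eq_edgeSum, SimpleGraph.edgeSum_exchange hva hxy,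
      SimpleGraph.edgeSum_exchange hva hxy, edgeLength_mk, edgeLength_mk, hd] at h
    rcases h with h | h
    · linarith
    · linarith [h.2]

/-- A finite point set of the plane has a minimum spanning tree of maximum degree at most `5`. -/
theorem exists_isMST_deg_le_five [Nonempty V] (hp : Function.Injective p) :
    ∃ T : SimpleGraph V, IsMST p T ∧ ∀ v, deg T v ≤ 5 := by
  classical
  obtain ⟨T, hT, hlex⟩ := exists_isMST_lex p (horizontalSq p)
  refine ⟨T, hT, fun v => ?_⟩
  by_contra! hdeg
  have hcard : 6 ≤ (T.neighborFinset v).card := by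
    rw [← Set.ncard_coe_finset, SimpleGraph.coe_neighborFinset]; exact hdeg
  obtain ⟨a, ha⟩ : (T.neighborFinset v).Nonempty := Finset.card_pos.1 (by omega)
  set u := p a - p v with hu
  -- At most two further neighbours lie on one side of the line through `v` and `a`; with two sides
  -- this leaves at most four, against the five that remain.
  have three : ∀ S : Finset V, S ⊆ (T.neighborFinset v).erase a →
      (∀ x ∈ S, ∀ y ∈ S, 0 ≤ cross u (p x - p v) * cross u (p y - p v)) → S.card ≤ 2 := by
    intro S hS hc
    by_contra! h3
    obtain ⟨b, hb, c, hc', d, hd, hbc, hbd, hcd⟩ := Finset.two_lt_card.1 h3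
    set z : Fin 3 → V := ![b, c, d] with hz
    have hzS : ∀ i, z i ∈ S := by intro i; fin_cases i <;> simp [hz, hb, hc', hd]
    have hzne : ∀ i j, i ≠ j → z i ≠ z j := by
      intro i j hij
      fin_cases i <;> fin_cases j <;> simp_all [hbc.symm, hbd.symm, hcd.symm]
    have hva : T.Adj v a := by simpa using ha
    have hadj : ∀ i, T.Adj v (z i) := fun i => by
      simpa using (Finset.mem_erase.1 (hS (hzS i))).2
    have hza : ∀ i, a ≠ z i := fun i => (Finset.mem_erase.1 (hS (hzS i))).1.symm
    have hne : ∀ b, T.Adj v b → p b - p v ≠ 0 := fun b hb =>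
      sub_ne_zero.2 (hp.ne hb.ne')
    obtain ⟨i, j, k, hij, hjk, hik, ej, ek, ni, nj⟩ := exists_hexagon (w := fun i => p (z i) - p v)
      (hne a hva) (fun i => hne _ (hadj i)) (fun i j => hc _ (hzS i) _ (hzS j))
      (fun i => hT.spread hva (hadj i) (hza i))
      (fun i j h => hT.spread (hadj i) (hadj j) (hzne i j h))
    -- With `t`, `s` the horizontal components of `p a - p v`, `p (z i) - p v`, the three
    -- equal-length exchanges give `t² ≤ (s - t)² ≤ s² ≤ t²`. All are equal, and since the lengths
    -- agree the same holds vertically, so `u = 0`.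
    have swap : ∀ x y, T.Adj v x → T.Adj v y → x ≠ y → dist (p v) (p x) = dist (p x) (p y) →
        horizontalSq p s(v, x) ≤ horizontalSq p s(x, y) := fun x y hx hy hxy hd =>
      hlex _ _ _ _ hx (hT.1.not_reachable_deleteEdge_of_adj hx hy hxy) hd
    have dv : ∀ x, dist (p v) (p x) = ‖p x - p v‖ := fun x => by rw [dist_comm, dist_eq_norm]
    have dxy : ∀ x y, dist (p x) (p y) = ‖(p y - p v) - (p x - p v)‖ := fun x y => by
      rw [dist_comm, dist_eq_norm]; congr 1; abel
    have s1 := swap a (z i) hva (hadj i) (hza i) (by rw [dv, dxy, ← ej, nj])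
    have s2 := swap (z i) (z j) (hadj i) (hadj j) (hzne _ _ hij) (by
      rw [dv, dxy, ej, ni, sub_sub_cancel_left, norm_neg])
    have s3 := swap (z j) (z k) (hadj j) (hadj k) (hzne _ _ hjk) (by
      rw [dv, dxy, nj, ek, ej, ← ni, ← norm_neg (p (z i) - p v)]; congr 1; abel)
    simp only [horizontalSq_mk] at s1 s2 s3
    have co : ∀ m : Fin 2, p (z j) m - p v m = p (z i) m - p v m - (p a m - p v m) ∧
        p (z k) m - p v m = -(p a m - p v m) := fun m =>
      ⟨by simpa using congrArg (fun q : Plane => q m) ej,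
        by simpa using congrArg (fun q : Plane => q m) ek⟩
    have nsq : ∀ q : Plane, ‖q‖ ^ 2 = q 0 ^ 2 + q 1 ^ 2 := fun q => by
      rw [← real_inner_self_eq_norm_sq, inner_plane]; ring
    have ni' : ‖p (z i) - p v‖ ^ 2 = ‖u‖ ^ 2 := by rw [ni]
    have nj' : ‖p (z j) - p v‖ ^ 2 = ‖u‖ ^ 2 := by rw [nj]
    rw [nsq, nsq, hu] at ni' nj'
    simp only [PiLp.sub_apply] at ni' nj'
    obtain ⟨⟨j0, k0⟩, ⟨j1, k1⟩⟩ := And.intro (co 0) (co 1)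
    have hu0 : ‖u‖ ^ 2 ≠ 0 := by
      have := norm_ne_zero_iff.2 (hne a hva); positivity
    rw [nsq, hu] at hu0
    simp only [PiLp.sub_apply] at hu0
    have r2 : p (z i) 0 - p (z j) 0 = p a 0 - p v 0 := by linarith
    have r3 : p (z j) 0 - p (z k) 0 = p (z i) 0 - p v 0 := by linarith
    have r4 : (p v 0 - p (z j) 0) ^ 2 = (p (z j) 0 - p v 0) ^ 2 := by ring
    rw [r3, r4, j0] at s3
    rw [r2] at s2
    rw [j0, j1] at nj'
    have r5 : (p v 0 - p a 0) ^ 2 = (p a 0 - p v 0) ^ 2 := by ring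
    have r6 : (p a 0 - p (z i) 0) ^ 2 = (p (z i) 0 - p v 0 - (p a 0 - p v 0)) ^ 2 := by ring
    have r7 : (p v 0 - p (z i) 0) ^ 2 = (p (z i) 0 - p v 0) ^ 2 := by ring
    rw [r5, r6] at s1
    rw [r7] at s2
    have q0 := eq_zero_of_sq_eq_sq_of_sub_sq_eq_sq (s := p (z i) 0 - p v 0)
      (t := p a 0 - p v 0) (by linarith) (by linarith)
    have q1 := eq_zero_of_sq_eq_sq_of_sub_sq_eq_sq (s := p (z i) 1 - p v 1)
      (t := p a 1 - p v 1) (by linarith) (by linarith)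
    exact hu0 (by rw [q0, q1]; norm_num)
  have hsplit := Finset.card_filter_add_card_filter_not (s := (T.neighborFinset v).erase a)
    (fun x => 0 ≤ cross u (p x - p v))
  have h1 := three (((T.neighborFinset v).erase a).filter fun x => 0 ≤ cross u (p x - p v))
    (Finset.filter_subset _ _) (fun x hx y hy =>
      mul_nonneg (Finset.mem_filter.1 hx).2 (Finset.mem_filter.1 hy).2)
  have h2 := three (((T.neighborFinset v).erase a).filter fun x => ¬ 0 ≤ cross u (p x - p v))
    (Finset.filter_subset _ _) (fun x hx y hy =>
      (mul_pos_of_neg_of_neg (not_le.1 (Finset.mem_filter.1 hx).2)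
        (not_le.1 (Finset.mem_filter.1 hy).2)).le)
  rw [Finset.card_erase_of_mem ha] at hsplit
  omega

end GeomTree

/-! ### Rooted trees -/

namespace GeomTree

section Rooting

variable {V : Type*} [Fintype V] {T : SimpleGraph V} {r : V} {par : V → V} {rank : V → ℕ}

/-- `par` is a parent function on the vertices of `T`, with root `r`. -/
structure IsRooting (T : SimpleGraph V) (r : V) (par : V → V) (rank : V → ℕ) : Prop where
  adj : ∀ x, x ≠ r → T.Adj x (par x)
  rank_lt : ∀ x, x ≠ r → rank (par x) < rank x

/-- `c` is a child of `v`. -/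
def IsChild (r : V) (par : V → V) (c v : V) : Prop := c ≠ r ∧ par c = v

/-- The parent is the next vertex on a shortest walk to `r`. The rank is left general in `IsRooting`
because the program uses the position in its queue instead of the distance. -/
theorem exists_isRooting (hT : T.Connected) (r : V) :
    ∃ par, IsRooting T r par fun x => T.dist x r := by
  have : ∀ x, ∃ y, x ≠ r → T.Adj x y ∧ T.dist y r < T.dist x r := by
    intro x
    rcases eq_or_ne x r with hx | hx
    · exact ⟨x, fun h => absurd hx h⟩
    obtain ⟨w, hw⟩ := (hT.preconnected x r).exists_walk_length_eq_dist
    cases w with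
    | nil => exact absurd rfl hx
    | @cons _ y _ h w =>
      refine ⟨y, fun _ => ⟨h, ?_⟩⟩
      rw [← hw, SimpleGraph.Walk.length_cons]
      exact Nat.lt_succ_of_le (SimpleGraph.dist_le w)
  choose par hpar using this
  exact ⟨par, fun x hx => (hpar x hx).1, fun x hx => (hpar x hx).2⟩

theorem IsRooting.injOn (h : IsRooting T r par rank) :
    Set.InjOn (fun x => s(x, par x)) {x | x ≠ r} := by
  intro x hx y hy hxy
  rcases Sym2.eq_iff.1 hxy with h1 | h1
  · exact h1.1
  · have h2 := h.rank_lt x hx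
    have h3 := h.rank_lt y hy
    rw [h1.2] at h2
    rw [← h1.1] at h3
    omega

/-- The `n - 1` edges from the non-root vertices to their parents are distinct, so they exhaust the
edges of the tree. -/
theorem IsRooting.adj_iff (h : IsRooting T r par rank) (hT : T.IsTree) {x y : V} :
    T.Adj x y ↔ IsChild r par x y ∨ IsChild r par y x := by
  classical
  refine ⟨fun hxy => ?_, ?_⟩
  · have hsub : (Finset.univ.erase r).image (fun x => s(x, par x)) ⊆ T.edgeFinset := by
      intro e he
      obtain ⟨x, hx, rfl⟩ := Finset.mem_image.1 he
      simpa using h.adj x (Finset.mem_erase.1 hx).1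
    have hcard : ((Finset.univ.erase r).image (fun x => s(x, par x))).card = T.edgeFinset.card := by
      rw [Finset.card_image_of_injOn (fun x hx y hy => h.injOn (by simpa using hx) (by simpa using hy)),
        Finset.card_erase_of_mem (Finset.mem_univ r), Finset.card_univ, ← hT.card_edgeFinset]
      simp
    have hmem : s(x, y) ∈ T.edgeFinset := by simpa using hxy
    rw [← Finset.eq_of_subset_of_card_le hsub hcard.ge] at hmem
    obtain ⟨z, hz, hzxy⟩ := Finset.mem_image.1 hmem
    have hz' := (Finset.mem_erase.1 hz).1
    rcases Sym2.eq_iff.1 hzxy with ⟨rfl, h1⟩ | ⟨rfl, h1⟩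
    · exact Or.inl ⟨hz', h1⟩
    · exact Or.inr ⟨hz', h1⟩
  · rintro (⟨h1, rfl⟩ | ⟨h1, rfl⟩)
    · exact h.adj _ h1
    · exact (h.adj _ h1).symm

theorem IsChild.ne (h : IsRooting T r par rank) {c v : V} (hc : IsChild r par c v) : c ≠ v :=
  fun e => (h.adj c hc.1).ne (e.trans hc.2.symm)

theorem IsChild.adj (h : IsRooting T r par rank) {c v : V} (hc : IsChild r par c v) :
    T.Adj v c := by
  have := (h.adj c hc.1).symm
  rwa [hc.2] at this

theorem IsChild.rank_lt (h : IsRooting T r par rank) {c v : V} (hc : IsChild r par c v) :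
    rank v < rank c := hc.2 ▸ h.rank_lt c hc.1

theorem IsRooting.par_ne_child (h : IsRooting T r par rank) {c v : V} (hv : v ≠ r)
    (hc : IsChild r par c v) : c ≠ par v := by
  intro e
  have h1 := hc.rank_lt h
  have h2 := h.rank_lt v hv
  rw [e] at h1
  omega

open Classical in
theorem IsRooting.card_children (h : IsRooting T r par rank) (hT : T.IsTree) {v : V} (hv : v ≠ r) :
    (Finset.univ.filter fun c => IsChild r par c v).card + 1 = deg T v := by
  have h1 : T.neighborSet v = ↑(insert (par v) (Finset.univ.filter fun c => IsChild r par c v)) := by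
    ext y
    simp only [SimpleGraph.mem_neighborSet, Finset.coe_insert, Finset.coe_filter, Finset.mem_univ,
      true_and, Set.mem_insert_iff]
    rw [h.adj_iff hT]
    constructor
    · rintro (h2 | h2)
      · exact Or.inl h2.2.symm
      · exact Or.inr h2
    · rintro (h2 | h2)
      · exact Or.inl ⟨hv, h2.symm⟩
      · exact Or.inr h2
  rw [deg, h1, Set.ncard_coe_finset, Finset.card_insert_of_notMem]
  intro hmem
  exact h.par_ne_child hv (Finset.mem_filter.1 hmem).2 rfl

end Rooting

/-! ### Pairing the neighbours of one vertex -/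

section Local

variable {V : Type*} [Fintype V] {T : SimpleGraph V} {r : V} {par : V → V} {rank : V → ℕ}
  {p : V → Plane} {A up : V → V} {v : V} {m : ℕ}

open Classical in
/-- The choices made at the vertex `v`.  The parent of `v` gets attached to `A v`, which is `v` or
a child of `v`; the child `c` of `v` keeps its place below `v` if `up c = v` and is attached to its
sibling `up c` otherwise. -/
structure LocalChoice (r : V) (par : V → V) (p : V → Plane) (A up : V → V) (m : ℕ) (v : V) :
    Prop where
  top : A v = v ∨ IsChild r par (A v) v ∧ up (A v) = v ∧
    0 ≤ inner ℝ (p (par v) - p v) (p (A v) - p v)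
  child : ∀ c, IsChild r par c v → up c = v ∨ IsChild r par (up c) v ∧ up (up c) = v ∧
    up c ≠ A v ∧ 0 ≤ inner ℝ (p c - p v) (p (up c) - p v)
  inj : ∀ c c', IsChild r par c v → IsChild r par c' v → up c ≠ v → up c = up c' → c = c'
  card : (Finset.univ.filter fun c => IsChild r par c v ∧ up c = v).card
    + (if A v = v then 1 else 0) ≤ m

/-- No change has been made at `v`. -/
def Unchanged (r : V) (par A up : V → V) (v : V) : Prop :=
  A v = v ∧ ∀ c, IsChild r par c v → up c = v

/-- The neighbour `a` of `v` is not yet in a pair. -/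
def Unpaired (r : V) (par A up : V → V) (v a : V) : Prop :=
  (a = par v → A v = v) ∧
    (IsChild r par a v → up a = v ∧ a ≠ A v ∧ ∀ c, IsChild r par c v → up c ≠ a)

/-- Only `A v` and the values of `up` on the children of `v` matter, which makes the choices at
different vertices independent. -/
theorem LocalChoice.congr {A' up' : V → V} (h : LocalChoice r par p A up m v) (hA : A' v = A v)
    (hup : ∀ c, IsChild r par c v → up' c = up c) : LocalChoice r par p A' up' m v := by
  classical
  constructor
  · rw [hA]
    refine h.top.imp id fun h1 => ⟨h1.1, ?_⟩
    rw [hup _ h1.1]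
    exact h1.2
  · intro c hc
    rw [hA, hup c hc]
    refine (h.child c hc).imp id fun h1 => ⟨h1.1, ?_⟩
    rw [hup _ h1.1]
    exact h1.2
  · intro c c' hc hc'
    rw [hup c hc, hup c' hc']
    exact h.inj c c' hc hc'
  · rw [hA]
    refine le_trans (le_of_eq ?_) h.card
    congr 2
    apply Finset.filter_congr
    intro c _
    exact and_congr_right fun hc => by rw [hup c hc]

theorem Unchanged.congr {A' up' : V → V} (h : Unchanged r par A up v) (hA : A' v = A v)
    (hup : ∀ c, IsChild r par c v → up' c = up c) : Unchanged r par A' up' v :=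
  ⟨hA.trans h.1, fun c hc => (hup c hc).trans (h.2 c hc)⟩

theorem Unchanged.localChoice (hr : IsRooting T r par rank) (hT : T.IsTree) (hv : v ≠ r)
    (h : Unchanged r par A up v) (hm : deg T v ≤ m) : LocalChoice r par p A up m v := by
  classical
  refine ⟨Or.inl h.1, fun c hc => Or.inl (h.2 c hc), fun c c' hc _ h1 => absurd (h.2 c hc) h1, ?_⟩
  rw [if_pos h.1]
  refine le_trans ?_ ((hr.card_children hT hv).le.trans hm)
  gcongr with c
  exact And.left

theorem Unchanged.unpaired (hr : IsRooting T r par rank) (h : Unchanged r par A up v) (a : V) :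
    Unpaired r par A up v a :=
  ⟨fun _ => h.1, fun ha => ⟨h.2 a ha, by rw [h.1]; exact ha.ne hr,
    fun c hc e => ha.ne hr (e.symm.trans (h.2 c hc))⟩⟩

open Classical in
/-- The choices after the neighbours `a` and `b` of `v` have been paired. -/
noncomputable def pairUp (par : V → V) (v a b : V) (s : (V → V) × (V → V)) :
    (V → V) × (V → V) :=
  if a = par v then (Function.update s.1 v b, s.2)
  else if b = par v then (Function.update s.1 v a, s.2)
  else (s.1, Function.update s.2 a b)

-- The pair consists of the parent and the child `b`: `v` hands its upward edge to `b`, and the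
-- summand for `A v = v` disappears.
open Classical in
theorem LocalChoice.attach (hr : IsRooting T r par rank)
    (h : LocalChoice r par p A up (m + 1) v) {b : V} (hb : IsChild r par b v) (hA : A v = v)
    (hub : Unpaired r par A up v b) (hin : 0 ≤ inner ℝ (p (par v) - p v) (p b - p v)) :
    LocalChoice r par p (Function.update A v b) up m v := by
  constructor
  · rw [Function.update_self]
    exact Or.inr ⟨hb, (hub.2 hb).1, hin⟩
  · intro c hc
    rw [Function.update_self]
    exact (h.child c hc).imp id fun h1 => ⟨h1.1, h1.2.1, (hub.2 hb).2.2 c hc, h1.2.2.2⟩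
  · exact h.inj
  · have := h.card
    rw [if_pos hA] at this
    rw [Function.update_self, if_neg (hb.ne hr)]
    omega

-- The pair consists of two children: `a` moves from `v` to its sibling `b` and leaves the set of
-- kept children.
open Classical in
theorem LocalChoice.link (hr : IsRooting T r par rank)
    (h : LocalChoice r par p A up (m + 1) v) {a b : V} (ha : IsChild r par a v)
    (hb : IsChild r par b v) (hab : a ≠ b)
    (hua : Unpaired r par A up v a) (hub : Unpaired r par A up v b)
    (hin : 0 ≤ inner ℝ (p a - p v) (p b - p v)) :
    LocalChoice r par p A (Function.update up a b) m v := by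
  constructor
  · refine h.top.imp id fun h1 => ⟨h1.1, ?_, h1.2.2⟩
    rw [Function.update_of_ne (hua.2 ha).2.1.symm]
    exact h1.2.1
  · intro c hc
    by_cases hca : c = a
    · subst hca
      rw [Function.update_self, Function.update_of_ne hab.symm]
      exact Or.inr ⟨hb, (hub.2 hb).1, (hub.2 hb).2.1, hin⟩
    · rw [Function.update_of_ne hca, Function.update_of_ne ((hua.2 ha).2.2 c hc)]
      exact h.child c hc
  · intro c c' hc hc'
    by_cases hca : c = a <;> by_cases hca' : c' = a
    · intros; rw [hca, hca']
    · rw [hca, Function.update_self, Function.update_of_ne hca']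
      intro _ e
      exact absurd e.symm ((hub.2 hb).2.2 c' hc')
    · rw [hca', Function.update_self, Function.update_of_ne hca]
      intro _ e
      exact absurd e ((hub.2 hb).2.2 c hc)
    · rw [Function.update_of_ne hca, Function.update_of_ne hca']
      exact h.inj c c' hc hc'
  · have hlt : (Finset.univ.filter fun c => IsChild r par c v ∧ Function.update up a b c = v).card
        < (Finset.univ.filter fun c => IsChild r par c v ∧ up c = v).card := by
      apply Finset.card_lt_card
      rw [Finset.ssubset_iff_of_subset]
      · refine ⟨a, by simpa using ⟨ha, (hua.2 ha).1⟩, ?_⟩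
        simp only [Finset.mem_filter, Finset.mem_univ, true_and, Function.update_self, not_and]
        exact fun _ => hb.ne hr
      · intro c
        simp only [Finset.mem_filter, Finset.mem_univ, true_and]
        rintro ⟨hc, h1⟩
        refine ⟨hc, ?_⟩
        by_cases hca : c = a
        · rw [hca, Function.update_self] at h1
          exact absurd h1 (hb.ne hr)
        · rwa [Function.update_of_ne hca] at h1
    have := h.card
    omega

/-- Pairing up two free neighbours at a non-obtuse angle lowers the number of edges at `v`. -/
theorem LocalChoice.pairUp (hr : IsRooting T r par rank) (hT : T.IsTree)
    {s : (V → V) × (V → V)}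
    (h : LocalChoice r par p s.1 s.2 (m + 1) v) {a b : V} (ha : T.Adj v a) (hb : T.Adj v b)
    (hab : a ≠ b) (hua : Unpaired r par s.1 s.2 v a) (hub : Unpaired r par s.1 s.2 v b)
    (hin : 0 ≤ inner ℝ (p a - p v) (p b - p v)) :
    LocalChoice r par p (pairUp par v a b s).1 (pairUp par v a b s).2 m v := by
  have child : ∀ x, T.Adj v x → x ≠ par v → IsChild r par x v := fun x hx hne =>
    ((hr.adj_iff hT).1 hx).resolve_left fun h1 => hne h1.2.symm
  unfold GeomTree.pairUp
  split_ifs with h1 h2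
  · subst h1
    exact h.attach hr (child b hb hab.symm) (hua.1 rfl) hub hin
  · subst h2
    exact h.attach hr (child a ha hab) (hub.1 rfl) hua (by rwa [real_inner_comm])
  · exact h.link hr (child a ha h1) (child b hb h2) hab hua hub hin

/-- This allows a second, disjoint pair at a vertex of degree five. -/
theorem Unpaired.pairUp {s : (V → V) × (V → V)} {a b c : V}
    (h : Unpaired r par s.1 s.2 v c) (hac : a ≠ c) (hbc : b ≠ c) :
    Unpaired r par (pairUp par v a b s).1 (pairUp par v a b s).2 v c := by
  unfold GeomTree.pairUp
  split_ifs with h1 h2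
  · refine ⟨fun e => absurd (h1.trans e.symm) hac, fun hc => ⟨(h.2 hc).1, ?_, (h.2 hc).2.2⟩⟩
    simpa using hbc.symm
  · refine ⟨fun e => absurd (h2.trans e.symm) hbc, fun hc => ⟨(h.2 hc).1, ?_, (h.2 hc).2.2⟩⟩
    simpa using hac.symm
  · refine ⟨h.1, fun hc => ⟨?_, (h.2 hc).2.1, fun d hd => ?_⟩⟩
    · simpa [hac.symm] using (h.2 hc).1
    · by_cases hda : d = a
      · simpa [hda] using hbc
      · simpa [hda] using (h.2 hc).2.2 d hd

theorem pairUp_fst_of_ne (par : V → V) {v a b w : V} (s : (V → V) × (V → V)) (h : w ≠ v) :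
    (pairUp par v a b s).1 w = s.1 w := by
  classical
  unfold pairUp
  split_ifs <;> simp [h]

/-- The second component changes at most at `a`, and only when `a` is a child of `v`, hence not of
`w`. -/
theorem pairUp_snd_of_not_adj (hr : IsRooting T r par rank) (hT : T.IsTree) {v a b c w : V}
    (s : (V → V) × (V → V)) (ha : T.Adj v a) (hc : IsChild r par c w) (hvw : w ≠ v) :
    (pairUp par v a b s).2 c = s.2 c := by
  classical
  unfold pairUp
  split_ifs with h1 h2
  · rfl
  · rfl
  · refine Function.update_of_ne (f := s.2) ?_ _
    rintro rfl
    rcases (hr.adj_iff hT).1 ha with h3 | h3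
    · exact h1 h3.2.symm
    · exact hvw (hc.2.symm.trans h3.2)

end Local

end GeomTree

/-! ### The new tree: connectedness, edge lengths, degrees -/

namespace GeomTree

section Global

variable {V : Type*} [Fintype V] {T : SimpleGraph V} {r : V} {par : V → V} {rank : V → ℕ}
  {p : V → Plane} {s s' : (V → V) × (V → V)} {v : V}

/-- The choices `s` are complete at the vertices of `S` and unchanged elsewhere. -/
structure Processed (r : V) (par : V → V) (p : V → Plane) (S : Set V)
    (s : (V → V) × (V → V)) : Prop where
  done : ∀ v ∈ S, v ≠ r → LocalChoice r par p s.1 s.2 3 v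
  todo : ∀ v, v ∉ S ∨ v = r → Unchanged r par s.1 s.2 v

/-- One step of the transformation: at the vertex `v` of degree `d + 3`, pair up `d` disjoint pairs
of neighbours at non-obtuse angles. -/
def PairingStep (T : SimpleGraph V) (par : V → V) (p : V → Plane) (v : V)
    (s s' : (V → V) × (V → V)) : Prop :=
  (deg T v ≤ 3 ∧ s' = s) ∨
  (deg T v = 4 ∧ ∃ a b, T.Adj v a ∧ T.Adj v b ∧ a ≠ b ∧ 0 ≤ inner ℝ (p a - p v) (p b - p v) ∧
    s' = pairUp par v a b s) ∨
  (deg T v = 5 ∧ ∃ a b c d, (∀ x ∈ [a, b, c, d], T.Adj v x) ∧ [a, b, c, d].Nodup ∧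
    0 ≤ inner ℝ (p a - p v) (p b - p v) ∧ 0 ≤ inner ℝ (p c - p v) (p d - p v) ∧
    s' = pairUp par v c d (pairUp par v a b s))

/-- An unchanged vertex satisfies the bound with its degree, and each of the disjoint pairs lowers
it by one, down to three. -/
theorem PairingStep.localChoice (hr : IsRooting T r par rank) (hT : T.IsTree) (hv : v ≠ r)
    (hs : Unchanged r par s.1 s.2 v) (h : PairingStep T par p v s s') :
    LocalChoice r par p s'.1 s'.2 3 v := by
  rcases h with ⟨hd, rfl⟩ | ⟨hd, a, b, ha, hb, hab, hin, rfl⟩ |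
    ⟨hd, a, b, c, d, hadj, hnd, hab, hcd, rfl⟩
  · exact hs.localChoice hr hT hv hd
  · exact (hs.localChoice hr hT hv hd.le).pairUp hr hT ha hb hab (hs.unpaired hr a)
      (hs.unpaired hr b) hin
  · simp only [List.nodup_cons, List.mem_cons, List.not_mem_nil, or_false, not_or] at hnd
    obtain ⟨⟨n1, n2, n3⟩, ⟨n4, n5⟩, n6, -⟩ := hnd
    have ha := hadj a (by simp)
    have hb := hadj b (by simp)
    have hc := hadj c (by simp)
    have hd' := hadj d (by simp)
    exact ((hs.localChoice hr hT hv hd.le).pairUp hr hT ha hb n1 (hs.unpaired hr a)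
      (hs.unpaired hr b) hab).pairUp hr hT hc hd' n6 ((hs.unpaired hr c).pairUp n2 n4)
        ((hs.unpaired hr d).pairUp n3 n5) hcd

theorem PairingStep.eq_of_ne (hr : IsRooting T r par rank) (hT : T.IsTree)
    (h : PairingStep T par p v s s') {w : V} (hw : w ≠ v) :
    s'.1 w = s.1 w ∧ ∀ c, IsChild r par c w → s'.2 c = s.2 c := by
  rcases h with ⟨hd, rfl⟩ | ⟨hd, a, b, ha, hb, hab, hin, rfl⟩ |
    ⟨hd, a, b, c, d, hadj, hnd, hab, hcd, rfl⟩
  · exact ⟨rfl, fun _ _ => rfl⟩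
  · exact ⟨pairUp_fst_of_ne _ _ hw, fun c hc => pairUp_snd_of_not_adj hr hT _ ha hc hw⟩
  · exact ⟨(pairUp_fst_of_ne _ _ hw).trans (pairUp_fst_of_ne _ _ hw), fun x hx =>
      (pairUp_snd_of_not_adj hr hT _ (hadj c (by simp)) hx hw).trans
        (pairUp_snd_of_not_adj hr hT _ (hadj a (by simp)) hx hw)⟩

/-- The vertices may be treated in any order; the program takes them in the order of their indices.
-/
theorem Processed.step (hr : IsRooting T r par rank) (hT : T.IsTree) {S : Set V}
    (hs : Processed r par p S s) (hv : v ≠ r) (hvS : v ∉ S) (h : PairingStep T par p v s s') :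
    Processed r par p (insert v S) s' := by
  constructor
  · intro w hw hwr
    by_cases hwv : w = v
    · rw [hwv]
      exact h.localChoice hr hT hv (hs.todo v (Or.inl hvS))
    · obtain ⟨h1, h2⟩ := h.eq_of_ne hr hT hwv
      exact (hs.done w (hw.resolve_left hwv) hwr).congr h1 h2
  · intro w hw
    have hwv : w ≠ v := by
      rintro rfl
      rcases hw with hw | hw
      · exact hw (Set.mem_insert _ _)
      · exact hv hw
    obtain ⟨h1, h2⟩ := h.eq_of_ne hr hT hwv
    exact (hs.todo w (hw.imp_left fun h3 h4 => h3 (Set.mem_insert_of_mem _ h4))).congr h1 h2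

theorem IsMST.exists_disjoint_pairs (hT : IsMST p T) (hp : Function.Injective p) {z : Fin 5 → V}
    (hz : Function.Injective z) (hadj : ∀ i, T.Adj v (z i)) :
    ∃ i j k l : Fin 5, [i, j, k, l].Nodup ∧ 0 ≤ inner ℝ (p (z i) - p v) (p (z j) - p v) ∧
      0 ≤ inner ℝ (p (z k) - p v) (p (z l) - p v) :=
  exists_two_disjoint_pairs (w := fun i => p (z i) - p v)
    (fun i => sub_ne_zero.2 (hp.ne (hadj i).ne')) fun i j hij =>
      hT.spread (hadj i) (hadj j) (hz.ne hij)

theorem exists_injective_of_deg_eq {k : ℕ} (h : deg T v = k) :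
    ∃ z : Fin k → V, Function.Injective z ∧ ∀ i, T.Adj v (z i) := by
  have hf : (T.neighborSet v).Finite := Set.toFinite _
  have e : Nat.card (T.neighborSet v) = k := h
  have := Finite.equivFinOfCardEq e
  exact ⟨fun i => (this.symm i).1, Subtype.val_injective.comp this.symm.injective,
    fun i => (this.symm i).2⟩

theorem IsMST.exists_pairingStep (hT : IsMST p T) (hp : Function.Injective p)
    (hd : deg T v ≤ 5) (par : V → V) (s : (V → V) × (V → V)) :
    ∃ s', PairingStep T par p v s s' := by
  rcases (by omega : deg T v ≤ 3 ∨ deg T v = 4 ∨ deg T v = 5) with h | h | h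
  · exact ⟨s, Or.inl ⟨h, rfl⟩⟩
  · obtain ⟨z, hz, hadj⟩ := exists_injective_of_deg_eq h
    obtain ⟨i, j, hij, hin⟩ := exists_pair fun i => p (z i) - p v
    exact ⟨_, Or.inr (Or.inl ⟨h, z i, z j, hadj i, hadj j, hz.ne hij, hin, rfl⟩)⟩
  · obtain ⟨z, hz, hadj⟩ := exists_injective_of_deg_eq h
    obtain ⟨i, j, k, l, hn, h1, h2⟩ := hT.exists_disjoint_pairs hp hz hadj
    refine ⟨_, Or.inr (Or.inr ⟨h, z i, z j, z k, z l, by simp [hadj], ?_, h1, h2, rfl⟩)⟩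
    exact hn.map hz

theorem IsMST.exists_processed (hT : IsMST p T) (hp : Function.Injective p)
    (hd : ∀ v, deg T v ≤ 5) (hr : IsRooting T r par rank) :
    ∃ s, Processed r par p Set.univ s := by
  classical
  suffices H : ∀ S : Finset V, r ∉ S → ∃ s, Processed r par p S s by
    obtain ⟨s, hs⟩ := H (Finset.univ.erase r) (by simp)
    refine ⟨s, fun v _ hv => hs.done v (by simpa using hv) hv, fun v hv => hs.todo v ?_⟩
    simpa using hv
  intro S
  induction S using Finset.induction_on with
  | empty => exact fun _ => ⟨(id, par), fun v hv => absurd hv (by simp), fun v _ => ⟨rfl, fun c hc => hc.2⟩⟩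
  | insert v S hv ih =>
    intro hrS
    rw [Finset.mem_insert, not_or] at hrS
    obtain ⟨s, hs⟩ := ih hrS.2
    obtain ⟨s', hs'⟩ := hT.exists_pairingStep (v := v) hp (hd v) par s
    refine ⟨s', ?_⟩
    rw [Finset.coe_insert]
    exact hs.step hr hT.1 (Ne.symm hrS.1) (by simpa using hv) hs'

open Classical in
/-- The edge of the new tree that stands for the edge between `x` and its parent. -/
noncomputable def newEnds (par : V → V) (s : (V → V) × (V → V)) (x : V) : V × V :=
  if s.2 x = par x then (par x, s.1 x) else (x, s.2 x)

/-- The new tree. -/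
def newTree (r : V) (par : V → V) (s : (V → V) × (V → V)) : SimpleGraph V :=
  SimpleGraph.fromEdgeSet {e | ∃ x, x ≠ r ∧ e = s((newEnds par s x).1, (newEnds par s x).2)}

/-- The two ways in which an edge of the new tree arises. -/
theorem newEnds_cases (hs : Processed r par p Set.univ s) {x : V}
    (hx : x ≠ r) :
    (s.2 x = par x ∧ newEnds par s x = (par x, s.1 x) ∧ (s.1 x = x ∨ IsChild r par (s.1 x) x ∧
      s.2 (s.1 x) = x ∧ 0 ≤ inner ℝ (p (par x) - p x) (p (s.1 x) - p x))) ∨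
    (s.2 x ≠ par x ∧ newEnds par s x = (x, s.2 x) ∧ par x ≠ r ∧ IsChild r par (s.2 x) (par x) ∧
      s.2 (s.2 x) = par x ∧ s.2 x ≠ s.1 (par x) ∧
      0 ≤ inner ℝ (p x - p (par x)) (p (s.2 x) - p (par x))) := by
  by_cases h : s.2 x = par x
  · exact Or.inl ⟨h, by rw [newEnds, if_pos h], (hs.done x (Set.mem_univ _) hx).top⟩
  · have hpr : par x ≠ r := fun e => h ((hs.todo r (Or.inr rfl)).2 x ⟨hx, e⟩ |>.trans e.symm)
    exact Or.inr ⟨h, by rw [newEnds, if_neg h], hpr,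
      ((hs.done _ (Set.mem_univ _) hpr).child x ⟨hx, rfl⟩).resolve_left h⟩

theorem newEnds_ne (hr : IsRooting T r par rank) (hs : Processed r par p Set.univ s) {x : V}
    (hx : x ≠ r) : (newEnds par s x).1 ≠ (newEnds par s x).2 := by
  rcases newEnds_cases hs hx with ⟨h1, h2, h3 | h3⟩ | ⟨h1, h2, h3, h4, h5, -⟩
  · rw [h2]; simp only [h3]; exact (hr.adj x hx).ne'
  · rw [h2]; exact (hr.par_ne_child hx h3.1).symm
  · rw [h2]
    intro e
    rw [← (show x = s.2 x from e)] at h5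
    exact h1 h5

theorem newTree_adj (hr : IsRooting T r par rank) (hs : Processed r par p Set.univ s) {u w : V} :
    (newTree r par s).Adj u w ↔ ∃ x, x ≠ r ∧
      ((newEnds par s x).1 = u ∧ (newEnds par s x).2 = w ∨
        (newEnds par s x).1 = w ∧ (newEnds par s x).2 = u) := by
  rw [newTree, SimpleGraph.fromEdgeSet_adj]
  constructor
  · rintro ⟨⟨x, hx, he⟩, hne⟩
    refine ⟨x, hx, ?_⟩
    rcases Sym2.eq_iff.1 he with ⟨rfl, rfl⟩ | ⟨rfl, rfl⟩ <;> simp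
  · rintro ⟨x, hx, ⟨rfl, rfl⟩ | ⟨rfl, rfl⟩⟩
    · exact ⟨⟨x, hx, rfl⟩, newEnds_ne hr hs hx⟩
    · exact ⟨⟨x, hx, Sym2.eq_swap⟩, (newEnds_ne hr hs hx).symm⟩

theorem newTree_adj_newEnds (hr : IsRooting T r par rank) (hs : Processed r par p Set.univ s)
    {x : V} (hx : x ≠ r) : (newTree r par s).Adj (newEnds par s x).1 (newEnds par s x).2 :=
  (newTree_adj hr hs).2 ⟨x, hx, Or.inl ⟨rfl, rfl⟩⟩

theorem newTree_connected (hr : IsRooting T r par rank) (hs : Processed r par p Set.univ s) :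
    (newTree r par s).Connected := by
  set G := newTree r par s
  obtain ⟨N, hN⟩ := (Set.finite_range rank).bddAbove
  have hN' : ∀ x, rank x ≤ N := fun x => hN ⟨x, rfl⟩
  -- Induction away from the root: if `s.1 x` is a child, its edge to `x` was kept, so the new tree
  -- has the edge from `x` to `s.1 (s.1 x)`.
  have claim1 : ∀ k x, N - rank x ≤ k → x ≠ r → G.Reachable x (s.1 x) := by
    intro k
    induction k using Nat.strong_induction_on with
    | _ k ih =>
      intro x hk hx
      rcases (hs.done x (Set.mem_univ _) hx).top with h | ⟨hc, hup, -⟩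
      · rw [h]
      · have hlt := hc.rank_lt hr
        have h1 := ih (N - rank (s.1 x)) (by have := hN' (s.1 x); omega) _ le_rfl hc.1
        have h2 := newTree_adj_newEnds hr hs hc.1
        rw [newEnds, if_pos (hup.trans hc.2.symm), hc.2] at h2
        exact h2.reachable.trans h1.symm
  have claim2 : ∀ x, x ≠ r → s.2 x = par x → G.Reachable x (par x) := by
    intro x hx h
    have h2 := newTree_adj_newEnds hr hs hx
    rw [newEnds, if_pos h] at h2
    exact (claim1 _ x le_rfl hx).trans h2.reachable.symm
  -- A moved vertex hangs on a sibling that was itself kept below the common parent.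
  have claim3 : ∀ x, x ≠ r → G.Reachable x (par x) := by
    intro x hx
    rcases newEnds_cases hs hx with ⟨h1, -⟩ | ⟨h1, h2, h3, h4, h5, -⟩
    · exact claim2 x hx h1
    · have h6 := newTree_adj_newEnds hr hs hx
      rw [h2] at h6
      have h7 := claim2 _ h4.1 (h5.trans h4.2.symm)
      rw [h4.2] at h7
      exact h6.reachable.trans h7
  have claim4 : ∀ k x, rank x ≤ k → G.Reachable x r := by
    intro k
    induction k using Nat.strong_induction_on with
    | _ k ih =>
      intro x hk
      by_cases hx : x = r
      · rw [hx]
      · have := hr.rank_lt x hx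
        exact (claim3 x hx).trans (ih _ (by omega) _ le_rfl)
  exact (SimpleGraph.connected_iff _).2
    ⟨fun x y => (claim4 _ x le_rfl).trans (claim4 _ y le_rfl).symm, ⟨r⟩⟩

/-- There is at most one edge per non-root vertex. Together with connectedness this gives a tree,
without a proof that these edges are distinct. -/
theorem card_newTree_edgeSet_le (r : V) (par : V → V) (s : (V → V) × (V → V)) :
    Nat.card (newTree r par s).edgeSet + 1 ≤ Nat.card V := by
  classical
  have hsub : (newTree r par s).edgeSet ⊆ ↑((Finset.univ.erase r).image fun x =>
      s((newEnds par s x).1, (newEnds par s x).2)) := by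
    rw [newTree, SimpleGraph.edgeSet_fromEdgeSet]
    rintro e ⟨⟨x, hx, rfl⟩, -⟩
    simp only [Finset.coe_image, Set.mem_image]
    exact ⟨x, by simpa using hx, rfl⟩
  have h1 := Set.ncard_le_ncard hsub (Finset.finite_toSet _)
  rw [Set.ncard_coe_finset] at h1
  have h2 := h1.trans Finset.card_image_le
  rw [Finset.card_erase_of_mem (Finset.mem_univ r), Finset.card_univ] at h2
  have h3 : 0 < Fintype.card V := Fintype.card_pos_iff.2 ⟨r⟩
  rw [Nat.card_coe_set_eq, Nat.card_eq_fintype_card]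
  omega

theorem newTree_isTree (hr : IsRooting T r par rank) (hs : Processed r par p Set.univ s) :
    (newTree r par s).IsTree := by
  have h := newTree_connected hr hs
  exact SimpleGraph.isTree_iff_connected_and_card.2
    ⟨h, le_antisymm (card_newTree_edgeSet_le r par s) h.card_vert_le_card_edgeSet_add_one⟩

theorem longestEdge_newTree_le (hr : IsRooting T r par rank) (hs : Processed r par p Set.univ s) :
    longestEdge p (newTree r par s) ≤ √2 * longestEdge p T := by
  have hL := longestEdge_nonneg p T
  have h2 : longestEdge p T ≤ √2 * longestEdge p T :=
    le_mul_of_one_le_left hL (Real.one_le_sqrt.2 one_le_two)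
  have key : ∀ a b c, T.Adj c a → T.Adj c b → 0 ≤ inner ℝ (p a - p c) (p b - p c) →
      dist (p a) (p b) ≤ √2 * longestEdge p T := by
    intro a b c ha hb hin
    have h := norm_sub_le_of_inner_nonneg (L := longestEdge p T) hin
      (by rw [← dist_eq_norm]; exact edgeLength_le_longestEdge p ha.symm)
      (by rw [← dist_eq_norm]; exact edgeLength_le_longestEdge p hb.symm)
    rwa [sub_sub_sub_cancel_right, ← dist_eq_norm] at h
  -- A new edge is an old one, or joins two neighbours in `T` of a single vertex: of `x` when the
  -- parent is attached to a child of `x`, of `par x` when `x` is hung on a sibling.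
  have main : ∀ x, x ≠ r →
      dist (p (newEnds par s x).1) (p (newEnds par s x).2) ≤ √2 * longestEdge p T := by
    intro x hx
    rcases newEnds_cases hs hx with ⟨-, h2, h3 | ⟨h3, -, h4⟩⟩ | ⟨-, h2, h3, h4, -, -, h5⟩
    · rw [h2]
      simp only [h3]
      exact (edgeLength_le_longestEdge p (hr.adj x hx).symm).trans ‹_›
    · rw [h2]
      exact key _ _ x (hr.adj x hx) (h3.adj hr) h4
    · rw [h2]
      exact key _ _ _ (hr.adj x hx).symm (h4.adj hr) h5
  refine longestEdge_le (by positivity) fun u w huw => ?_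
  obtain ⟨x, hx, ⟨rfl, rfl⟩ | ⟨rfl, rfl⟩⟩ := (newTree_adj hr hs).1 huw
  · exact main x hx
  · rw [dist_comm]; exact main x hx

/-- The neighbours of `v` in the new tree that come from the choices at the parent of `v`. -/
def extraNeighbors (r : V) (par : V → V) (s : (V → V) × (V → V)) (v : V) : Set V :=
  {w | v ≠ r ∧ s.2 v ≠ par v ∧ w = s.2 v ∨ w ≠ r ∧ s.2 w ≠ par w ∧ v = s.2 w ∨
    IsChild r par v (par v) ∧ par v ≠ r ∧ v = s.1 (par v) ∧ w = par (par v)}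

/-- Being moved to a sibling, receiving a sibling and receiving the grandparent each use a pair at
`par v` that contains `v`; disjoint pairs allow only one of these. -/
theorem extraNeighbors_subsingleton (hr : IsRooting T r par rank)
    (hs : Processed r par p Set.univ s) :
    (extraNeighbors r par s v).Subsingleton := by
  have linked : ∀ x, x ≠ r → s.2 x ≠ par x → par x ≠ r ∧ IsChild r par (s.2 x) (par x) ∧
      s.2 (s.2 x) = par x ∧ s.2 x ≠ s.1 (par x) := by
    intro x hx hux
    rcases newEnds_cases hs hx with h | h
    · exact absurd h.1 hux
    · exact ⟨h.2.2.1, h.2.2.2.1, h.2.2.2.2.1, h.2.2.2.2.2.1⟩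
  have two : ∀ w, w ≠ r → s.2 w ≠ par w → v = s.2 w → s.2 v = par v ∧ v ≠ s.1 (par v) := by
    intro w hw hne e
    obtain ⟨-, h2, h3, h4⟩ := linked w hw hne
    rw [← e] at h2 h3 h4
    exact ⟨h3.trans h2.2.symm, by rwa [h2.2]⟩
  have top : v ≠ r → par v ≠ r → v = s.1 (par v) → s.2 v = par v := by
    intro hv hpv e
    rcases (hs.done _ (Set.mem_univ _) hpv).top with h | h
    · rw [← e] at h
      exact absurd h (hr.adj v hv).ne
    · rw [← e] at h
      exact h.2.1
  rintro w hw w' hw'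
  rcases hw with ⟨h1, h2, h3⟩ | ⟨h1, h2, h3⟩ | ⟨h1, h2, h3, h4⟩ <;>
  rcases hw' with ⟨h1', h2', h3'⟩ | ⟨h1', h2', h3'⟩ | ⟨h1', h2', h3', h4'⟩
  · rw [h3, h3']
  · exact absurd (two w' h1' h2' h3').1 h2
  · exact absurd (top h1 h2' h3') h2
  · exact absurd (two w h1 h2 h3).1 h2'
  · obtain ⟨k1, k2, -⟩ := linked w h1 h2
    obtain ⟨-, k2', -⟩ := linked w' h1' h2'
    rw [← h3] at k2
    rw [← h3'] at k2'
    exact (hs.done _ (Set.mem_univ _) k1).inj w w' ⟨h1, rfl⟩ ⟨h1', k2'.2.symm.trans k2.2⟩ h2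
      (h3.symm.trans h3')
  · exact absurd h3' (two w h1 h2 h3).2
  · exact absurd (top h1.1 h2 h3) h2'
  · exact absurd h3 (two w' h1' h2' h3').2
  · rw [h4, h4']

theorem extraNeighbors_eq_empty (hs : Processed r par p Set.univ s) (hv : IsChild r par v r) :
    extraNeighbors r par s v = ∅ := by
  rw [Set.eq_empty_iff_forall_notMem]
  rintro w (⟨-, h2, -⟩ | ⟨h1, h2, h3⟩ | ⟨-, h2, -⟩)
  · exact h2 (((hs.todo r (Or.inr rfl)).2 v hv).trans hv.2.symm)
  · rcases newEnds_cases hs h1 with h | ⟨-, -, h4, h5, -⟩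
    · exact h2 h.1
    · rw [← h3] at h5
      exact h4 (h5.2.symm.trans hv.2)
  · exact h2 hv.2

/-- A kept child `c` accounts for the neighbour `s.1 c`, and the parent for one more if `s.1 v = v`;
the local bound covers these. All other neighbours come from the choices at the parent. -/
theorem deg_newTree_le (hr : IsRooting T r par rank) (hs : Processed r par p Set.univ s)
    (hv : v ≠ r) : deg (newTree r par s) v ≤ 3 + (extraNeighbors r par s v).ncard := by
  classical
  have hsub : (newTree r par s).neighborSet v ⊆
      (↑((Finset.univ.filter fun c => IsChild r par c v ∧ s.2 c = v).image s.1) ∪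
        ↑(if s.1 v = v then {par v} else ∅ : Finset V)) ∪ extraNeighbors r par s v := by
    intro w hw
    obtain ⟨x, hx, h⟩ := (newTree_adj hr hs).1 hw
    rcases newEnds_cases hs hx with ⟨h1, h2, h3⟩ | ⟨h1, h2, h3, h4, h5, -⟩ <;> rw [h2] at h <;>
    rcases h with ⟨rfl, rfl⟩ | ⟨rfl, rfl⟩
    · left; left
      simp only [Finset.coe_image, Set.mem_image, Finset.coe_filter, Finset.mem_univ, true_and]
      exact ⟨x, ⟨⟨hx, rfl⟩, h1⟩, rfl⟩
    · rcases h3 with h3 | h3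
      · left; right
        simp [h3]
      · right; right; right
        by_cases hxr : x = r
        · exact absurd hxr hx
        · exact ⟨⟨hv, rfl⟩, by rw [h3.1.2]; exact hx, by simp only [h3.1.2], by simp only [h3.1.2]⟩
    · right; left
      exact ⟨hv, h1, rfl⟩
    · right; right; left
      exact ⟨hx, h1, rfl⟩
  have h1 := Set.ncard_le_ncard hsub (Set.toFinite _)
  have h2 := h1.trans (Set.ncard_union_le _ _)
  rw [← Finset.coe_union, Set.ncard_coe_finset] at h2
  have h3 := (hs.done v (Set.mem_univ _) hv).card
  have h4 := Finset.card_union_le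
    ((Finset.univ.filter fun c => IsChild r par c v ∧ s.2 c = v).image s.1)
    (if s.1 v = v then {par v} else ∅ : Finset V)
  have h5 := Finset.card_image_le (s := Finset.univ.filter fun c => IsChild r par c v ∧ s.2 c = v)
    (f := s.1)
  have h6 : (if s.1 v = v then {par v} else ∅ : Finset V).card = if s.1 v = v then 1 else 0 := by
    split_ifs <;> simp
  unfold deg
  omega

/-- Nothing is paired at the root, so its only edge stems from its only child `c` and ends at `s.1
c`. -/
theorem deg_newTree_root (hr : IsRooting T r par rank) (hT : T.IsTree)
    (hs : Processed r par p Set.univ s) (hd : deg T r = 1) : deg (newTree r par s) r = 1 := by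
  obtain ⟨c, hc⟩ := Set.ncard_eq_one.1 hd
  have huniq : ∀ x, IsChild r par x r → x = c := fun x hx => by
    have : x ∈ T.neighborSet r := hx.adj hr
    rwa [hc] at this
  have hcr : IsChild r par c r := by
    have : c ∈ T.neighborSet r := by rw [hc]; rfl
    rcases (hr.adj_iff hT).1 this with h | h
    · exact absurd rfl h.1
    · exact h
  refine Set.ncard_eq_one.2 ⟨s.1 c, Set.Subset.antisymm ?_ ?_⟩
  · intro w hw
    obtain ⟨x, hx, h⟩ := (newTree_adj hr hs).1 hw
    rcases newEnds_cases hs hx with ⟨h1, h2, h3⟩ | ⟨h1, h2, h3, h4, -⟩ <;> rw [h2] at h <;>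
    rcases h with ⟨h, rfl⟩ | ⟨rfl, h⟩
    · rw [huniq x ⟨hx, h⟩]; rfl
    · rcases h3 with h3 | h3
      · exact absurd (h3.symm.trans h) hx
      · exact absurd h h3.1.1
    · exact absurd h hx
    · exact absurd h h4.1
  · rintro _ rfl
    have h := newTree_adj_newEnds hr hs hcr.1
    rw [newEnds, if_pos (((hs.todo r (Or.inr rfl)).2 c hcr).trans hcr.2.symm), hcr.2] at h
    exact h

/-- The transformation of a minimum spanning tree of maximum degree at most `5`. -/
theorem newTree_isDegreeTree (hr : IsRooting T r par rank) (hT : T.IsTree)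
    (hs : Processed r par p Set.univ s) (hd : deg T r = 1) :
    IsDegreeTree 4 (newTree r par s) := by
  refine ⟨newTree_isTree hr hs, fun v => ?_⟩
  by_cases hv : v = r
  · rw [hv, deg_newTree_root hr hT hs hd]; omega
  · have h1 := deg_newTree_le hr hs hv
    have h2 := Set.ncard_le_one_iff_subsingleton.2 (extraNeighbors_subsingleton (v := v) hr hs)
    omega

theorem IsMST.exists_isDegreeTree (hT : IsMST p T) (hp : Function.Injective p)
    (hd : ∀ v, deg T v ≤ 5) {r v : V} (hr : deg T r = 1) (hrv : T.Adj r v) :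
    ∃ T' : SimpleGraph V, IsDegreeTree 4 T' ∧ deg T' r = 1 ∧ deg T' v ≤ 3 ∧
      longestEdge p T' ≤ √2 * longestEdge p T := by
  obtain ⟨par, hpar⟩ := exists_isRooting hT.1.connected r
  obtain ⟨s, hs⟩ := hT.exists_processed hp hd hpar
  refine ⟨newTree r par s, newTree_isDegreeTree hpar hT.1 hs hr,
    deg_newTree_root hpar hT.1 hs hr, ?_, longestEdge_newTree_le hpar hs⟩
  have hv : IsChild r par v r := ((hpar.adj_iff hT.1).1 hrv).resolve_left fun h => h.1 rfl
  have h := deg_newTree_le hpar hs hv.1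
  rwa [extraNeighbors_eq_empty hs hv, Set.ncard_empty] at h

theorem exists_leaf [Nontrivial V] (hT : T.IsTree) : ∃ r v, deg T r = 1 ∧ T.Adj r v := by
  classical
  obtain ⟨r, hr⟩ := hT.exists_vert_degree_one_of_nontrivial
  have h : deg T r = 1 := by
    rw [← hr, ← SimpleGraph.card_neighborFinset_eq_degree, ← Set.ncard_coe_finset,
      SimpleGraph.coe_neighborFinset]
    rfl
  obtain ⟨v, hv⟩ := Set.ncard_eq_one.1 h
  exact ⟨r, v, h, by rw [← SimpleGraph.mem_neighborSet, hv]; rfl⟩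

theorem longestEdge_eq_zero [Subsingleton V] (p : V → Plane) (G : SimpleGraph V) :
    longestEdge p G = 0 :=
  le_antisymm (longestEdge_le le_rfl fun u v h => absurd (Subsingleton.elim u v) h.ne)
    (longestEdge_nonneg p G)

theorem deg_eq_zero_of_subsingleton [Subsingleton V] (G : SimpleGraph V) (v : V) :
    deg G v = 0 := by
  rw [deg, Set.ncard_eq_zero, Set.eq_empty_iff_forall_notMem]
  exact fun w h => (SimpleGraph.Adj.ne h) (Subsingleton.elim _ _)

/-- A finite point set of the plane has a spanning tree of maximum degree at most `4` within a
factor `√2` of the bottleneck spanning trees. -/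
theorem exists_isDegreeTree_four [Nonempty V] (hp : Function.Injective p) :
    ∃ T' : SimpleGraph V, IsDegreeTree 4 T' ∧ ∀ B : SimpleGraph V, B.Connected →
      longestEdge p T' ≤ √2 * longestEdge p B := by
  obtain ⟨T, hT, hd⟩ := exists_isMST_deg_le_five hp
  -- A single point offers no leaf to serve as a root; there `T` itself has no edges.
  rcases subsingleton_or_nontrivial V with hV | hV
  · exact ⟨T, ⟨hT.1, fun v => by rw [deg_eq_zero_of_subsingleton]; omega⟩, fun B _ => by
      simp [longestEdge_eq_zero]⟩
  · obtain ⟨r, v, hr, hrv⟩ := exists_leaf hT.1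
    obtain ⟨T', h1, -, -, h2⟩ := hT.exists_isDegreeTree hp hd hr hrv
    exact ⟨T', h1, fun B hB => h2.trans (by gcongr; exact hT.longestEdge_le hB)⟩

theorem points_injective (P : Finset Plane) : Function.Injective (points P) :=
  Subtype.val_injective

theorem beta_four_le : beta 4 ≤ ENNReal.ofReal (√2) := by
  refine iSup_le fun P => iSup_le fun hP => iSup_le fun D => iSup_le fun hD => iSup_le fun B =>
    iSup_le fun hB => ENNReal.ofReal_le_ofReal ?_
  have : Nonempty P := (Finset.card_pos.1 (by omega)).to_subtype
  obtain ⟨T, hT, h⟩ := exists_isDegreeTree_four (points_injective P)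
  exact div_le_of_le_mul₀ (longestEdge_nonneg _ _) (by positivity)
    ((hD.2 T hT).trans (h B hB.1.connected))

end Global

end GeomTree

/-! ### Loop-free programs and counting loops -/

namespace RealRAM

open Classical in
/-- The effect of a program without loops. -/
noncomputable def Cmd.run : Cmd → Store → Store
  | .skip, s => s
  | .setVar x e, s => s.updVar x (e.eval s)
  | .setNat a i e, s => s.updNat a (i.eval s) (e.eval s)
  | .setReal a i e, s => s.updReal a (i.eval s) (e.eval s)
  | .seq c d, s => d.run (c.run s)
  | .branch b c d, s => if b.Holds s then c.run s else d.run s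
  | .loop _ _, s => s

/-- An upper bound for the number of steps of a program without loops. -/
def Cmd.time : Cmd → ℕ
  | .skip => 1
  | .setVar _ e => e.cost + 1
  | .setNat _ i e => i.cost + e.cost + 1
  | .setReal _ i e => i.cost + e.cost + 1
  | .seq c d => c.time + d.time
  | .branch b c d => b.cost + max c.time d.time + 1
  | .loop _ _ => 0

/-- The program has no loops. -/
def Cmd.LoopFree : Cmd → Prop
  | .seq c d => c.LoopFree ∧ d.LoopFree
  | .branch _ c d => c.LoopFree ∧ d.LoopFree
  | .loop _ _ => False
  | _ => True

/-- All loop bodies of the program are loop-free, so they can be evaluated by `run` and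
simplification; only `runs_forLoop` unfolds a loop. -/
theorem Cmd.LoopFree.exec {c : Cmd} (hc : c.LoopFree) (s : Store) :
    ∃ t, Exec c s (c.run s) t ∧ t ≤ c.time := by
  induction c generalizing s with
  | skip => exact ⟨_, .skip s, le_rfl⟩
  | setVar x e => exact ⟨_, .setVar s x e, le_rfl⟩
  | setNat a i e => exact ⟨_, .setNat s a i e, le_rfl⟩
  | setReal a i e => exact ⟨_, .setReal s a i e, le_rfl⟩
  | seq c d ihc ihd =>
    obtain ⟨t, h1, h2⟩ := ihc hc.1 s
    obtain ⟨u, h3, h4⟩ := ihd hc.2 (c.run s)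
    exact ⟨_, .seq h1 h3, Nat.add_le_add h2 h4⟩
  | branch b c d ihc ihd =>
    simp only [Cmd.run, Cmd.time]
    split_ifs with hb
    · obtain ⟨t, h1, h2⟩ := ihc hc.1 s
      exact ⟨_, .branchTrue hb h1, by omega⟩
    · obtain ⟨t, h1, h2⟩ := ihd hc.2 s
      exact ⟨_, .branchFalse hb h1, by omega⟩
  | loop b c => exact hc.elim

/-- Started in `s`, the program `c` halts after at most `t` steps, in a memory that satisfies `Q`. -/
def Runs (c : Cmd) (s : Store) (t : ℕ) (Q : Store → Prop) : Prop :=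
  ∃ s' u, Exec c s s' u ∧ u ≤ t ∧ Q s'

theorem Cmd.LoopFree.runs {c : Cmd} (hc : c.LoopFree) {s : Store} {Q : Store → Prop}
    (h : Q (c.run s)) : Runs c s c.time Q := by
  obtain ⟨t, h1, h2⟩ := hc.exec s
  exact ⟨_, t, h1, h2, h⟩

theorem Runs.seq {c d : Cmd} {s : Store} {t u : ℕ} {Q R : Store → Prop} (hc : Runs c s t Q)
    (hd : ∀ s', Q s' → Runs d s' u R) : Runs (.seq c d) s (t + u) R := by
  obtain ⟨s', t', h1, h2, h3⟩ := hc
  obtain ⟨s'', u', h4, h5, h6⟩ := hd s' h3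
  exact ⟨s'', _, .seq h1 h4, Nat.add_le_add h2 h5, h6⟩

theorem Runs.mono {c : Cmd} {s : Store} {t u : ℕ} {Q : Store → Prop} (hc : Runs c s t Q)
    (h : t ≤ u) : Runs c s u Q := by
  obtain ⟨s', t', h1, h2, h3⟩ := hc
  exact ⟨s', t', h1, h2.trans h, h3⟩

/-- The loop `for i from 0 to N - 1 do c`, where variable `1` is `i` and `N` is the value of `e`. -/
def forLoop (e : NExpr) (c : Cmd) : Cmd :=
  .seq (.setVar 1 (.lit 0))
    (.loop (.ltN (.var 1) e) (.seq c (.setVar 1 (.add (.var 1) (.lit 1)))))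

/-- The number of steps of a loop with `N` rounds is at most `N + 1` times this. -/
def forLoopCost (e : NExpr) (c : Cmd) : ℕ := c.time + e.cost + 20

/-- The invariant `I k` is meant before round `k`, when the counter is already `k`. The body must
preserve the counter, because the increment follows it. The extra summand in `N + 1` pays for the
initialization and the final test. -/
theorem runs_forLoop {e : NExpr} {c : Cmd} (hc : c.LoopFree) {N : ℕ} (I : ℕ → Store → Prop)
    (hN : ∀ k s, I k s → e.eval s = N)
    (hstep : ∀ k s, k < N → I k s → s.var 1 = k →
      (c.run s).var 1 = k ∧ I (k + 1) ((c.run s).updVar 1 (k + 1)))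
    {s : Store} (h0 : I 0 (s.updVar 1 0)) :
    Runs (forLoop e c) s ((N + 1) * forLoopCost e c) (I N) := by
  set b : BExpr := .ltN (.var 1) e with hb
  set d : Cmd := .seq c (.setVar 1 (.add (.var 1) (.lit 1))) with hd
  have hdf : d.LoopFree := ⟨hc, trivial⟩
  have hbc : b.cost + d.time + 1 ≤ forLoopCost e c := by
    simp only [hb, hd, BExpr.cost, NExpr.cost, Cmd.time, forLoopCost]; omega
  have loop : ∀ m k s, k + m = N → I k s → s.var 1 = k →
      Runs (.loop b d) s (m * forLoopCost e c + (b.cost + 1)) (I N) := by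
    intro m
    induction m with
    | zero =>
      intro k s hk hI hv
      have hnot : ¬ b.Holds s := by
        simp only [hb, BExpr.Holds, NExpr.eval, hN k s hI, hv]; omega
      exact ⟨s, _, .loopFalse hnot, by omega, by rwa [← hk]⟩
    | succ m ih =>
      intro k s hk hI hv
      have hyes : b.Holds s := by
        simp only [hb, BExpr.Holds, NExpr.eval, hN k s hI, hv]; omega
      obtain ⟨t, h1, h2⟩ := hdf.exec s
      obtain ⟨h3, h4⟩ := hstep k s (by omega) hI hv
      have h5 : d.run s = (c.run s).updVar 1 (k + 1) := by
        simp only [hd, Cmd.run, NExpr.eval, h3]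
      rw [h5] at h1
      obtain ⟨s', u, h6, h7, h8⟩ := ih (k + 1) _ (by omega) h4 (by simp [Store.updVar])
      refine ⟨s', _, .loopTrue hyes h1 h6, ?_, h8⟩
      rw [Nat.succ_mul]
      omega
  have hset : (Cmd.setVar 1 (.lit 0)).LoopFree := trivial
  refine ((hset.runs (Q := fun s' => s' = s.updVar 1 0) rfl).seq (u := N * forLoopCost e c + (b.cost + 1))
    (R := I N) ?_).mono ?_
  · rintro _ rfl
    exact loop N 0 _ (by omega) h0 (by simp [Store.updVar])
  · rw [Nat.succ_mul]
    simp only [hb, BExpr.cost, NExpr.cost, Cmd.time, forLoopCost]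
    omega

/-- Runs the command of the first test that holds. -/
def firstMatch : List (BExpr × Cmd) → Cmd
  | [] => .skip
  | bc :: l => .branch bc.1 bc.2 (firstMatch l)

theorem firstMatch_loopFree {l : List (BExpr × Cmd)} (h : ∀ bc ∈ l, bc.2.LoopFree) :
    (firstMatch l).LoopFree := by
  induction l with
  | nil => trivial
  | cons bc l ih => exact ⟨h bc (by simp), ih fun x hx => h x (by simp [hx])⟩

theorem run_firstMatch {l : List (BExpr × Cmd)} {s : Store} (h : ∃ bc ∈ l, bc.1.Holds s) :
    ∃ bc ∈ l, bc.1.Holds s ∧ (firstMatch l).run s = bc.2.run s := by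
  induction l with
  | nil => simp at h
  | cons bc l ih =>
    by_cases hb : bc.1.Holds s
    · exact ⟨bc, by simp, hb, by simp [firstMatch, Cmd.run, hb]⟩
    · obtain ⟨x, hx, h1⟩ := h
      rcases List.mem_cons.1 hx with rfl | hx
      · exact absurd h1 hb
      · obtain ⟨y, hy, h2, h3⟩ := ih ⟨x, hx, h1⟩
        exact ⟨y, by simp [hy], h2, by simpa [firstMatch, Cmd.run, hb] using h3⟩

end RealRAM

/-! ### Reading the edges and finding a leaf -/

namespace RealRAM

/-- The index of slot `j` of the vertex `x`: every vertex has five slots. -/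
def slot (x j : NExpr) : NExpr := .add (.add (.add (.add (.add x x) x) x) x) j

theorem eval_slot (x j : NExpr) (s : Store) : (slot x j).eval s = 5 * x.eval s + j.eval s := by
  simp only [slot, NExpr.eval]; ring

/-- Appends the vertex in variable `b` to the neighbours of the vertex in variable `a`. -/
def addNeighbor (a b : ℕ) : Cmd :=
  .seq (.setNat 5 (slot (.var a) (.get 4 (.var a))) (.var b))
    (.setNat 4 (.var a) (.add (.get 4 (.var a)) (.lit 1)))

/-- Reads one edge. -/
def readEdge : Cmd :=
  .seq (.setVar 4 (.get 0 (.var 1))) (.seq (.setVar 5 (.get 1 (.var 1)))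
    (.seq (addNeighbor 4 5) (addNeighbor 5 4)))

/-- Computes the degrees in array `4` and the neighbours in array `5`. -/
def readEdges : Cmd := forLoop (.sub (.var 0) (.lit 1)) readEdge

/-- Finds a vertex of degree `1`, in variable `3`. -/
def findLeaf : Cmd :=
  forLoop (.var 0) (.branch (.eqN (.get 4 (.var 1)) (.lit 1)) (.setVar 3 (.var 1)) .skip)

variable {n : ℕ}

/-- The arrays `D` and `J` hold the lengths and the members of the lists `N x`. -/
def Represents (D J : ℕ → ℕ) (N : Fin n → List (Fin n)) : Prop :=
  ∀ x : Fin n, D x = (N x).length ∧ ∀ j (hj : j < (N x).length), J (5 * x + j) = ((N x)[j] : ℕ)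

/-- Lists of length at most five keep the slots of different vertices apart; the strict bound at `x`
leaves room for the new entry in its own block. -/
theorem Represents.append {D J : ℕ → ℕ} {N : Fin n → List (Fin n)} (h : Represents D J N)
    (x y : Fin n) (hN : ∀ z, (N z).length ≤ 5) (hx : (N x).length < 5) :
    Represents (Function.update D x (D x + 1)) (Function.update J (5 * x + D x) y)
      (Function.update N x (N x ++ [y])) := by
  intro z
  by_cases hz : z = x
  · subst hz
    refine ⟨by simp [(h z).1], fun j hj => ?_⟩
    simp only [Function.update_self] at hj ⊢
    rw [List.length_append, List.length_singleton] at hj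
    by_cases hj' : j = (N z).length
    · subst hj'
      rw [(h z).1]
      simp
    · have hlt : j < (N z).length := by omega
      rw [Function.update_of_ne (by rw [(h z).1]; omega), (h z).2 j hlt, List.getElem_append_left hlt]
  · have hzx : (z : ℕ) ≠ x := fun e => hz (Fin.ext e)
    rw [Function.update_of_ne hz, Function.update_of_ne hzx]
    refine ⟨(h z).1, fun j hj => ?_⟩
    rw [Function.update_of_ne, (h z).2 j hj]
    have h1 := hN z
    rw [(h x).1]
    omega

/-- The neighbours of `x` along the listed edges. -/
def neighborList (l : List (Fin n × Fin n)) (x : Fin n) : List (Fin n) :=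
  l.flatMap fun e => if e.1 = x then [e.2] else if e.2 = x then [e.1] else []

theorem neighborList_append (l : List (Fin n × Fin n)) {e : Fin n × Fin n} (he : e.1 ≠ e.2) :
    neighborList (l ++ [e]) = Function.update (Function.update (neighborList l) e.1
      (neighborList l e.1 ++ [e.2])) e.2 (neighborList l e.2 ++ [e.1]) := by
  funext x
  have h1 : neighborList (l ++ [e]) x = neighborList l x ++
      (if e.1 = x then [e.2] else if e.2 = x then [e.1] else []) := by
    simp [neighborList]
  rw [h1]
  by_cases hx2 : x = e.2
  · subst hx2
    simp [he]
  · rw [Function.update_of_ne hx2]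
    by_cases hx1 : x = e.1
    · subst hx1
      simp
    · rw [Function.update_of_ne hx1]
      simp [Ne.symm hx1, Ne.symm hx2]

variable {T : SimpleGraph (Fin n)} {l : List (Fin n × Fin n)}

theorem IsEdgeList.ne (hl : IsEdgeList T l) {e : Fin n × Fin n} (he : e ∈ l) : e.1 ≠ e.2 := by
  have : s(e.1, e.2) ∈ T.edgeSet := (hl.2 _).1 (List.mem_map.2 ⟨e, he, rfl⟩)
  exact T.ne_of_adj this

theorem IsEdgeList.mem_neighborList (hl : IsEdgeList T l) {x y : Fin n} :
    y ∈ neighborList l x ↔ T.Adj x y := by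
  rw [← SimpleGraph.mem_edgeSet, ← hl.2]
  simp only [neighborList, List.mem_flatMap, List.mem_map, Sym2.eq_iff]
  constructor
  · rintro ⟨e, he, h⟩
    refine ⟨e, he, ?_⟩
    split_ifs at h with h1 h2
    · left; exact ⟨h1, (List.mem_singleton.1 h).symm⟩
    · right; exact ⟨(List.mem_singleton.1 h).symm, h2⟩
    · simp at h
  · rintro ⟨e, he, ⟨h1, h2⟩ | ⟨h1, h2⟩⟩
    · exact ⟨e, he, by simp [h1, h2]⟩
    · have := hl.ne he
      refine ⟨e, he, ?_⟩
      rw [if_neg (by rw [← h2]; exact this), if_pos h2]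
      simp [h1]

theorem IsEdgeList.nodup_neighborList (hl : IsEdgeList T l) (x : Fin n) :
    (neighborList l x).Nodup := by
  rw [neighborList, List.nodup_flatMap]
  refine ⟨fun e _ => by split_ifs <;> simp, ?_⟩
  have h1 := List.pairwise_map.1 hl.1
  refine h1.imp fun {e f} hef => ?_
  simp only [Function.onFun, List.disjoint_left]
  intro y hy hy'
  apply hef
  rw [Sym2.eq_iff]
  split_ifs at hy with a1 a2 <;> split_ifs at hy' with a3 a4 <;> simp_all

theorem IsEdgeList.length_neighborList (hl : IsEdgeList T l) (x : Fin n) :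
    (neighborList l x).length = GeomTree.deg T x := by
  rw [← List.toFinset_card_of_nodup (hl.nodup_neighborList x), ← Set.ncard_coe_finset]
  unfold GeomTree.deg
  congr 1
  ext y
  simp [hl.mem_neighborList]

theorem IsEdgeList.length_add_one (hl : IsEdgeList T l) (hT : T.IsTree) : l.length + 1 = n := by
  classical
  have h2 : T.edgeSet.ncard = l.length := by
    rw [← List.length_map (as := l) fun e => s(e.1, e.2), ← List.toFinset_card_of_nodup hl.1,
      ← Set.ncard_coe_finset]
    congr 1
    ext e
    rw [List.coe_toFinset, ← hl.2]
    rfl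
  have h3 := (SimpleGraph.isTree_iff_connected_and_card.1 hT).2
  rw [Nat.card_coe_set_eq, h2, Nat.card_fin] at h3
  exact h3

theorem length_neighborList_take_le (l : List (Fin n × Fin n)) (k : ℕ) (x : Fin n) :
    (neighborList (l.take k) x).length ≤ (neighborList l x).length := by
  conv_rhs => rw [← List.take_append_drop k l]
  rw [neighborList, neighborList, List.flatMap_append, List.length_append]
  exact Nat.le_add_right _ _

/-- What is known after the edges have been read. -/
structure ReadState (p : Fin n → GeomTree.Plane) (N : Fin n → List (Fin n)) (s : Store) :
    Prop where
  size : s.var 0 = n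
  xcoord : ∀ x : Fin n, s.real 0 x = p x 0
  ycoord : ∀ x : Fin n, s.real 1 x = p x 1
  lists : Represents (s.nat 4) (s.nat 5) N

theorem runs_readEdges (p : Fin n → GeomTree.Plane) (hT : T.IsTree)
    (hd : ∀ x, GeomTree.deg T x ≤ 5) (hl : IsEdgeList T l) :
    Runs readEdges (inputStore p l) ((n - 1 + 1) * forLoopCost (.sub (.var 0) (.lit 1)) readEdge)
      fun s => ReadState p (neighborList l) s ∧ (∀ j, s.nat 6 j = 0) ∧ ∀ j, s.nat 7 j = 0 := by
  have hlen := hl.length_add_one hT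
  have h0 : ∀ j (hj : j < l.length), (inputStore p l).nat 0 j = (l[j].1 : ℕ) := fun j hj => by
    simp [inputStore, hj]
  have h1 : ∀ j (hj : j < l.length), (inputStore p l).nat 1 j = (l[j].2 : ℕ) := fun j hj => by
    simp [inputStore, hj]
  have h6 : ∀ a j, 2 ≤ a → (inputStore p l).nat a j = 0 := fun a j ha => by
    simp [inputStore, show a ≠ 0 by omega, show a ≠ 1 by omega]
  have hlf : readEdge.LoopFree := by simp [readEdge, addNeighbor, Cmd.LoopFree]
  -- The invariant also says that the input arrays are intact and that arrays `6` and `7` are still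
  -- zero; the search relies on the latter for marks and parents.
  have key := runs_forLoop (e := .sub (.var 0) (.lit 1)) hlf (N := n - 1) (s := inputStore p l)
    (fun k s => (ReadState p (neighborList (l.take k)) s ∧ (∀ j, s.nat 6 j = 0) ∧
      ∀ j, s.nat 7 j = 0) ∧ s.nat 0 = (inputStore p l).nat 0 ∧ s.nat 1 = (inputStore p l).nat 1)
    (fun k s h => by simp [NExpr.eval, h.1.1.size]) ?_ ?_
  · have hn : l.take (n - 1) = l := List.take_of_length_le (by omega)
    rw [hn] at key
    obtain ⟨s', u, k1, k2, k3⟩ := key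
    exact ⟨s', u, k1, k2, k3.1⟩
  · rintro k s hk ⟨⟨hs, hs6, hs7⟩, hs0, hs1⟩ hvar
    have hkl : k < l.length := by omega
    have e0 : s.nat 0 k = (l[k].1 : ℕ) := by rw [hs0, h0 k hkl]
    have e1 : s.nat 1 k = (l[k].2 : ℕ) := by rw [hs1, h1 k hkl]
    have hne : l[k].1 ≠ l[k].2 := hl.ne (List.getElem_mem hkl)
    have hne' : (l[k].1 : ℕ) ≠ l[k].2 := fun e => hne (Fin.ext e)
    have htake : l.take (k + 1) = l.take k ++ [l[k]] := by
      rw [List.take_add_one, List.getElem?_eq_getElem hkl, Option.toList_some]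
    have hupd := neighborList_append (l.take k) hne
    rw [← htake] at hupd
    have hle : ∀ m x, (neighborList (l.take m) x).length ≤ 5 := fun m x =>
      (length_neighborList_take_le l m x).trans ((hl.length_neighborList x).trans_le (hd x))
    -- The edge about to be read already counts in the list of the first `k + 1` edges, whose
    -- neighbour lists have length at most five.
    have hlt1 : (neighborList (l.take k) l[k].1).length < 5 := by
      have := hle (k + 1) l[k].1
      rw [hupd, Function.update_of_ne hne, Function.update_self, List.length_append,
        List.length_singleton] at this
      omega
    have hlt2 : (neighborList (l.take k) l[k].2).length < 5 := by
      have := hle (k + 1) l[k].2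
      rw [hupd, Function.update_self, List.length_append, List.length_singleton] at this
      omega
    have r1 := hs.lists.append l[k].1 l[k].2 (hle k) hlt1
    have r2 := r1.append l[k].2 l[k].1 (fun z => by
      by_cases hz : z = l[k].1
      · rw [hz, Function.update_self, List.length_append, List.length_singleton]; omega
      · rw [Function.update_of_ne hz]; exact hle k z) (by
      rw [Function.update_of_ne hne.symm]; exact hlt2)
    rw [Function.update_of_ne hne.symm, ← hupd] at r2
    refine ⟨?_, ⟨⟨?_, ?_, ?_, ?_⟩, ?_, ?_⟩, ?_, ?_⟩
    all_goals simp only [readEdge, addNeighbor, Cmd.run, NExpr.eval, eval_slot, Store.updVar,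
      Store.updNat, hvar, e0]
    · simp [hvar]
    · simpa using hs.size
    · simpa using hs.xcoord
    · simpa using hs.ycoord
    · simpa [e0, e1, hvar, hne'.symm] using r2
    · simpa using hs6
    · simpa using hs7
    · simpa using hs0
    · simpa using hs1
  · refine ⟨⟨⟨?_, ?_, ?_, ?_⟩, ?_, ?_⟩, ?_, ?_⟩
    · simp [inputStore, Store.updVar]
    · intro x; simp [inputStore, Store.updVar]
    · intro x; simp [inputStore, Store.updVar]
    · intro x; simp [neighborList, h6, Store.updVar]
    · intro j; simp [h6, Store.updVar]
    · intro j; simp [h6, Store.updVar]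
    · rfl
    · rfl

/-- The loop writes only variables, so any property `Q` of the arrays of natural numbers passes
through. -/
theorem runs_findLeaf {p : Fin n → GeomTree.Plane} {N : Fin n → List (Fin n)} {s : Store}
    (hs : ReadState p N s) {r : Fin n} (hr : (N r).length = 1) {Q : (ℕ → ℕ → ℕ) → Prop}
    (hQ : Q s.nat) :
    Runs findLeaf s ((n + 1) * forLoopCost (.var 0)
      (.branch (.eqN (.get 4 (.var 1)) (.lit 1)) (.setVar 3 (.var 1)) .skip))
      fun s => ReadState p N s ∧ Q s.nat ∧ ∃ r : Fin n, s.var 3 = r ∧ (N r).length = 1 := by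
  have key := runs_forLoop (e := .var 0)
    (c := .branch (.eqN (.get 4 (.var 1)) (.lit 1)) (.setVar 3 (.var 1)) .skip)
    (by simp [Cmd.LoopFree]) (N := n) (s := s)
    (fun k s => ReadState p N s ∧ Q s.nat ∧
      ((∃ r : Fin n, (r : ℕ) < k ∧ (N r).length = 1) → ∃ r : Fin n, s.var 3 = r ∧ (N r).length = 1))
    (fun k s h => h.1.size) ?_ ?_
  · obtain ⟨s', u, k1, k2, k3, k4, k5⟩ := key
    exact ⟨s', u, k1, k2, k3, k4, k5 ⟨r, r.2, hr⟩⟩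
  · rintro k s hk ⟨hs, hQ, hleaf⟩ hvar
    simp only [Cmd.run, BExpr.Holds, NExpr.eval, hvar]
    have hD := (hs.lists ⟨k, hk⟩).1
    simp only at hD
    split_ifs with h1
    · refine ⟨by simp [Store.updVar, hvar], ⟨?_, ?_, ?_, ?_⟩, by simpa [Store.updVar] using hQ,
        fun _ => ⟨⟨k, hk⟩, by simp [Store.updVar], by omega⟩⟩
      · simpa [Store.updVar] using hs.size
      · simpa [Store.updVar] using hs.xcoord
      · simpa [Store.updVar] using hs.ycoord
      · simpa [Store.updVar] using hs.lists
    · refine ⟨hvar, ⟨?_, ?_, ?_, ?_⟩, by simpa [Store.updVar] using hQ, ?_⟩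
      · simpa [Store.updVar] using hs.size
      · simpa [Store.updVar] using hs.xcoord
      · simpa [Store.updVar] using hs.ycoord
      · simpa [Store.updVar] using hs.lists
      · rintro ⟨r, hr, hr1⟩
        have hne : (r : ℕ) ≠ k := by
          rintro e
          have : r = ⟨k, hk⟩ := Fin.ext e
          rw [this] at hr1
          omega
        simpa [Store.updVar] using hleaf ⟨r, by omega, hr1⟩
  · refine ⟨⟨?_, ?_, ?_, ?_⟩, by simpa [Store.updVar] using hQ, ?_⟩
    · simpa [Store.updVar] using hs.size
    · simpa [Store.updVar] using hs.xcoord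
    · simpa [Store.updVar] using hs.ycoord
    · simpa [Store.updVar] using hs.lists
    · rintro ⟨r, hr, -⟩; omega

end RealRAM

/-! ### Breadth-first search -/

namespace RealRAM

/-- Visits the neighbour in slot `j` of the vertex in variable `4`. -/
def visit (j : ℕ) : Cmd :=
  .branch (.ltN (.lit j) (.get 4 (.var 4)))
    (.seq (.setVar 5 (.get 5 (slot (.var 4) (.lit j))))
      (.branch (.eqN (.get 6 (.var 5)) (.lit 0))
        (.seq (.setNat 6 (.var 5) (.lit 1)) (.seq (.setNat 7 (.var 5) (.var 4))
          (.seq (.setNat 8 (.var 2) (.var 5)) (.setVar 2 (.add (.var 2) (.lit 1)))))) .skip)) .skip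

/-- Visits all neighbours of the next vertex in the queue. -/
def visitAll : Cmd :=
  .seq (.setVar 4 (.get 8 (.var 1)))
    (.seq (visit 0) (.seq (visit 1) (.seq (visit 2) (.seq (visit 3) (visit 4)))))

/-- Breadth-first search from the vertex in variable `3`: computes the parents in array `7` and
the order of the visits in array `8`. -/
def search : Cmd :=
  .seq (.seq (.setNat 6 (.var 3) (.lit 1)) (.seq (.setNat 8 (.lit 0) (.var 3)) (.setVar 2 (.lit 1))))
    (forLoop (.var 0) visitAll)

variable {n : ℕ} {T : SimpleGraph (Fin n)} {p : Fin n → GeomTree.Plane}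
  {N : Fin n → List (Fin n)} {r : Fin n} {Q : List (Fin n)} {s : Store}

theorem ReadState.congr {s' : Store} (h : ReadState p N s) (h0 : s'.var 0 = s.var 0)
    (hr : s'.real = s.real) (h4 : s'.nat 4 = s.nat 4) (h5 : s'.nat 5 = s.nat 5) :
    ReadState p N s' :=
  ⟨h0.trans h.size, hr ▸ h.xcoord, hr ▸ h.ycoord, h4 ▸ h5 ▸ h.lists⟩

open Classical in
/-- The state of the search when the vertices in the queue are `Q`. -/
structure SearchState (T : SimpleGraph (Fin n)) (r : Fin n) (p : Fin n → GeomTree.Plane)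
    (N : Fin n → List (Fin n)) (Q : List (Fin n)) (s : Store) : Prop where
  read : ReadState p N s
  nodup : Q.Nodup
  head : Q.head? = some r
  length : s.var 2 = Q.length
  queue : ∀ j (hj : j < Q.length), s.nat 8 j = (Q[j] : ℕ)
  mark : ∀ y : Fin n, s.nat 6 y = if y ∈ Q then 1 else 0
  parent_lt : ∀ y : Fin n, s.nat 7 y < n
  parent : ∀ y ∈ Q, y ≠ r → ∃ z ∈ Q, s.nat 7 y = (z : ℕ) ∧ T.Adj y z ∧ Q.idxOf z < Q.idxOf y

theorem SearchState.congr {s' : Store} (h : SearchState T r p N Q s) (h0 : s'.var 0 = s.var 0)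
    (h2 : s'.var 2 = s.var 2) (hr : s'.real = s.real)
    (hn : ∀ a ∈ [4, 5, 6, 7, 8], s'.nat a = s.nat a) :
    SearchState T r p N Q s' where
  read := h.read.congr h0 hr (hn 4 (by simp)) (hn 5 (by simp))
  nodup := h.nodup
  head := h.head
  length := h2.trans h.length
  queue := by rw [hn 8 (by simp)]; exact h.queue
  mark := by rw [hn 6 (by simp)]; exact h.mark
  parent_lt := by rw [hn 7 (by simp)]; exact h.parent_lt
  parent := by rw [hn 7 (by simp)]; exact h.parent

/-- Appending at the end preserves old positions, so the parent `x` precedes `y` in the queue;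
positions can serve as ranks. -/
theorem SearchState.push (h : SearchState T r p N Q s) {x y : Fin n} (hx : x ∈ Q) (hy : y ∉ Q)
    (hxy : T.Adj x y) {s' : Store} (h0 : s'.var 0 = s.var 0) (h2 : s'.var 2 = s.var 2 + 1)
    (hr : s'.real = s.real) (h4 : s'.nat 4 = s.nat 4) (h5 : s'.nat 5 = s.nat 5)
    (h6 : s'.nat 6 = Function.update (s.nat 6) y 1)
    (h7 : s'.nat 7 = Function.update (s.nat 7) y x)
    (h8 : s'.nat 8 = Function.update (s.nat 8) (s.var 2) y) :
    SearchState T r p N (Q ++ [y]) s' where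
  read := h.read.congr h0 hr h4 h5
  nodup := by
    rw [List.nodup_append]
    refine ⟨h.nodup, by simp, fun a ha b hb => ?_⟩
    rw [List.mem_singleton.1 hb]
    rintro rfl
    exact hy ha
  head := by
    rw [List.head?_append, h.head]; rfl
  length := by rw [h2, h.length]; simp
  queue := by
    intro j hj
    rw [h8, h.length]
    rw [List.length_append, List.length_singleton] at hj
    by_cases hj' : j = Q.length
    · subst hj'; simp
    · have hlt : j < Q.length := by omega
      rw [Function.update_of_ne hj', h.queue j hlt, List.getElem_append_left hlt]
  mark := by
    intro z
    rw [h6]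
    by_cases hz : z = y
    · subst hz; simp
    · rw [Function.update_of_ne (fun e => hz (Fin.ext e)), h.mark z]
      simp [hz]
  parent_lt := by
    intro z
    rw [h7]
    by_cases hz : z = y
    · subst hz; simp
    · rw [Function.update_of_ne (fun e => hz (Fin.ext e))]
      exact h.parent_lt z
  parent := by
    intro z hz hzr
    by_cases hzy : z = y
    · subst hzy
      refine ⟨x, by simp [hx], by rw [h7]; simp, hxy.symm, ?_⟩
      rw [List.idxOf_append_of_mem hx, List.idxOf_append_of_notMem hy]
      have := List.idxOf_lt_length_of_mem hx
      omega
    · have hzQ : z ∈ Q := by simpa [hzy] using hz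
      obtain ⟨w, h9, h10, h11, h12⟩ := h.parent z hzQ hzr
      refine ⟨w, by simp [h9], ?_, h11, ?_⟩
      · rw [h7, Function.update_of_ne (fun e => hzy (Fin.ext e)), h10]
      · rwa [List.idxOf_append_of_mem h9, List.idxOf_append_of_mem hzQ]

theorem SearchState.visit (hN : ∀ x y, y ∈ N x ↔ T.Adj x y) (h : SearchState T r p N Q s)
    {x : Fin n} (hx : x ∈ Q) (hs : s.var 4 = x) (j : ℕ) :
    ∃ Q', Q <+: Q' ∧ SearchState T r p N Q' ((visit j).run s) ∧
      (∀ hj : j < (N x).length, (N x)[j] ∈ Q') ∧ ((RealRAM.visit j).run s).var 1 = s.var 1 ∧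
      ((RealRAM.visit j).run s).var 4 = x := by
  have hD := (h.read.lists x).1
  by_cases hj : j < (N x).length
  · have hJ := (h.read.lists x).2 j hj
    have hm := h.mark (N x)[j]
    by_cases hy : (N x)[j] ∈ Q
    · refine ⟨Q, List.prefix_rfl, ?_, fun _ => hy, ?_, ?_⟩
      · refine h.congr ?_ ?_ ?_ ?_ <;>
        simp [RealRAM.visit, Cmd.run, BExpr.Holds, NExpr.eval, eval_slot, Store.updVar,
          hs, hD, hj, hJ, hm, hy]
      · simp [RealRAM.visit, Cmd.run, BExpr.Holds, NExpr.eval, eval_slot, Store.updVar,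
          hs, hD, hj, hJ, hm, hy]
      · simp [RealRAM.visit, Cmd.run, BExpr.Holds, NExpr.eval, eval_slot, Store.updVar,
          hs, hD, hj, hJ, hm, hy]
    · refine ⟨Q ++ [(N x)[j]], List.prefix_append _ _, ?_, fun _ => by simp, ?_, ?_⟩
      · refine h.push hx hy ((hN _ _).1 (List.getElem_mem hj)) ?_ ?_ ?_ ?_ ?_ ?_ ?_ ?_ <;>
        simp [RealRAM.visit, Cmd.run, BExpr.Holds, NExpr.eval, eval_slot, Store.updVar, Store.updNat,
          hs, hD, hj, hJ, hm, hy]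
      · simp [RealRAM.visit, Cmd.run, BExpr.Holds, NExpr.eval, eval_slot, Store.updVar, Store.updNat,
          hs, hD, hj, hJ, hm, hy]
      · simp [RealRAM.visit, Cmd.run, BExpr.Holds, NExpr.eval, eval_slot, Store.updVar, Store.updNat,
          hs, hD, hj, hJ, hm, hy]
  · have hrun : (RealRAM.visit j).run s = s := by
      simp [RealRAM.visit, Cmd.run, BExpr.Holds, NExpr.eval, hs, hD, hj]
    rw [hrun]
    exact ⟨Q, List.prefix_rfl, h, fun hj' => absurd hj' hj, rfl, hs⟩

/-- Five fixed visits replace an inner loop, and slots beyond the degree are skipped. The old queue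
stays a prefix, so `Q[k]` does not move. -/
theorem SearchState.visitAll (hN : ∀ x y, y ∈ N x ↔ T.Adj x y) (h5 : ∀ x, (N x).length ≤ 5)
    (h : SearchState T r p N Q s) {k : ℕ} (hk : k < Q.length) (hs : s.var 1 = k) :
    ∃ Q', Q <+: Q' ∧ SearchState T r p N Q' (visitAll.run s) ∧ (∀ y, T.Adj Q[k] y → y ∈ Q') ∧
      (RealRAM.visitAll.run s).var 1 = k := by
  have h0 : SearchState T r p N Q (s.updVar 4 Q[k]) :=
    h.congr (by simp [Store.updVar]) (by simp [Store.updVar]) rfl (fun _ _ => rfl)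
  have hx : Q[k] ∈ Q := List.getElem_mem hk
  obtain ⟨Q1, p1, s1, m1, v1, w1⟩ := h0.visit hN hx (by simp [Store.updVar]) 0
  obtain ⟨Q2, p2, s2, m2, v2, w2⟩ := s1.visit hN (p1.subset hx) w1 1
  obtain ⟨Q3, p3, s3, m3, v3, w3⟩ := s2.visit hN ((p1.trans p2).subset hx) w2 2
  obtain ⟨Q4, p4, s4, m4, v4, w4⟩ := s3.visit hN ((p1.trans (p2.trans p3)).subset hx) w3 3
  obtain ⟨Q5, p5, s5, m5, v5, w5⟩ :=
    s4.visit hN ((p1.trans (p2.trans (p3.trans p4))).subset hx) w4 4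
  have hrun : RealRAM.visitAll.run s = (RealRAM.visit 4).run ((RealRAM.visit 3).run
      ((RealRAM.visit 2).run ((RealRAM.visit 1).run ((RealRAM.visit 0).run (s.updVar 4 Q[k]))))) := by
    simp [RealRAM.visitAll, Cmd.run, NExpr.eval, hs, h.queue k hk]
  rw [hrun]
  refine ⟨Q5, p1.trans (p2.trans (p3.trans (p4.trans p5))), s5, fun y hy => ?_, ?_⟩
  · obtain ⟨j, hj, rfl⟩ := List.getElem_of_mem ((hN _ _).2 hy)
    have hj5 := h5 Q[k]
    rcases (by omega : j = 0 ∨ j = 1 ∨ j = 2 ∨ j = 3 ∨ j = 4) with rfl | rfl | rfl | rfl | rfl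
    · exact (p2.trans (p3.trans (p4.trans p5))).subset (m1 hj)
    · exact (p3.trans (p4.trans p5)).subset (m2 hj)
    · exact (p4.trans p5).subset (m3 hj)
    · exact p5.subset (m4 hj)
    · exact m5 hj
  · rw [v5, v4, v3, v2, v1]
    simpa [Store.updVar] using hs

theorem mem_of_closed (hT : T.Connected) {S : Set (Fin n)} (hr : r ∈ S)
    (hS : ∀ x ∈ S, ∀ y, T.Adj x y → y ∈ S) (y : Fin n) : y ∈ S := by
  obtain ⟨w⟩ := hT.preconnected r y
  induction w with
  | nil => exact hr
  | cons h w ih => exact ih (hS _ hr _ h)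

theorem length_le_of_nodup {Q : List (Fin n)} (h : Q.Nodup) : Q.length ≤ n := by
  simpa using h.length_le_card

theorem length_eq_of_mem {Q : List (Fin n)} (h : Q.Nodup) (h1 : ∀ x, x ∈ Q) : Q.length = n := by
  rw [← List.toFinset_card_of_nodup h, (by ext x; simp [h1] : Q.toFinset = Finset.univ)]
  simp

theorem runs_search (hT : T.Connected) (hN : ∀ x y, y ∈ N x ↔ T.Adj x y)
    (h5 : ∀ x, (N x).length ≤ 5) (hs : ReadState p N s) (hr : s.var 3 = r)
    (h6 : ∀ j, s.nat 6 j = 0) (h7 : ∀ j, s.nat 7 j = 0) :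
    Runs search s (20 + (n + 1) * forLoopCost (.var 0) visitAll)
      fun s => ∃ Q, SearchState T r p N Q s ∧ ∀ x, x ∈ Q := by
  have hlf : visitAll.LoopFree := by simp [visitAll, visit, Cmd.LoopFree]
  have hinit : (Cmd.seq (.setNat 6 (.var 3) (.lit 1))
      (.seq (.setNat 8 (.lit 0) (.var 3)) (.setVar 2 (.lit 1)))).LoopFree := by
    simp [Cmd.LoopFree]
  have hmem : ∀ Q s, SearchState T r p N Q s → r ∈ Q := fun Q s h =>
    List.mem_of_mem_head? h.head
  have h1 := hinit.runs (s := s) (Q := fun s' => SearchState T r p N [r] s') ?_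
  · refine (h1.seq (u := (n + 1) * forLoopCost (.var 0) visitAll)
      (R := fun s => ∃ Q, SearchState T r p N Q s ∧ ∀ x, x ∈ Q) fun s' hs' => ?_).mono ?_
    · have key := runs_forLoop (e := .var 0) hlf (N := n) (s := s')
        (fun k s => ∃ Q, SearchState T r p N Q s ∧
          ∀ j (hj : j < Q.length), j < k → ∀ y, T.Adj Q[j] y → y ∈ Q)
        (fun k s h => by obtain ⟨Q, h, -⟩ := h; exact h.read.size) ?_ ?_
      · obtain ⟨s'', u, k1, k2, Q, k3, k4⟩ := key
        refine ⟨s'', u, k1, k2, Q, k3, fun x => ?_⟩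
        refine mem_of_closed hT (S := {x | x ∈ Q}) (hmem Q _ k3) (fun x hx y hxy => ?_) x
        obtain ⟨j, hj, rfl⟩ := List.getElem_of_mem hx
        exact k4 j hj (hj.trans_le (length_le_of_nodup k3.nodup)) y hxy
      · rintro k s hk ⟨Q, hQ, hcl⟩ hvar
        -- If the queue ran dry, it would be closed under adjacency, hence contain all `n` vertices
        -- by connectedness, against `k < n`.
        have hkQ : k < Q.length := by
          by_contra! hle
          have hall : ∀ x, x ∈ Q := fun x =>
            mem_of_closed hT (S := {x | x ∈ Q}) (hmem Q _ hQ) (fun x hx y hxy => by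
              obtain ⟨j, hj, rfl⟩ := List.getElem_of_mem hx
              exact hcl j hj (hj.trans_le hle) y hxy) x
          have := length_eq_of_mem hQ.nodup hall
          omega
        obtain ⟨Q', k1, k2, k3, k4⟩ := hQ.visitAll hN h5 hkQ hvar
        refine ⟨k4, Q', k2.congr (by simp [Store.updVar]) (by simp [Store.updVar]) rfl
          (fun _ _ => rfl), fun j hj hjk y hy => ?_⟩
        obtain ⟨R, rfl⟩ := k1
        rcases (by omega : j < k ∨ j = k) with h | rfl
        · rw [List.getElem_append_left (h.trans hkQ)] at hy
          exact List.mem_append_left _ (hcl j (h.trans hkQ) h y hy)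
        · rw [List.getElem_append_left hkQ] at hy
          exact k3 y hy
      · exact ⟨[r], hs'.congr (by simp [Store.updVar]) (by simp [Store.updVar]) rfl
          (fun _ _ => rfl), fun j _ hj => absurd hj (by omega)⟩
    · simp [Cmd.time, NExpr.cost]
  · constructor
    · exact hs.congr (by simp [Cmd.run, Store.updVar, Store.updNat]) rfl
        (by simp [Cmd.run, Store.updVar, Store.updNat]) (by simp [Cmd.run, Store.updVar, Store.updNat])
    · simp
    · rfl
    · simp [Cmd.run, Store.updVar, Store.updNat, NExpr.eval]
    · intro j hj
      obtain rfl : j = 0 := by simpa using hj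
      simp [Cmd.run, Store.updVar, Store.updNat, NExpr.eval, hr]
    · intro y
      by_cases hy : y = r
      · subst hy; simp [Cmd.run, Store.updVar, Store.updNat, NExpr.eval, hr]
      · have hy' : (y : ℕ) ≠ r := fun e => hy (Fin.ext e)
        simp [Cmd.run, Store.updVar, Store.updNat, NExpr.eval, hr, hy, hy', h6]
    -- Parents not yet set are `0`, a valid index since `n` is positive.
    · intro y
      simp [Cmd.run, Store.updVar, Store.updNat, h7, y.pos]
    · intro y hy hyr
      exact absurd (by simpa using hy) hyr

end RealRAM

/-! ### The pairing program, its output and its running time -/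

namespace RealRAM

/-- Initializes the choices: no vertex is paired. -/
def initChoice : Cmd :=
  .seq (.setNat 9 (.var 1) (.var 1)) (.setNat 10 (.var 1) (.get 7 (.var 1)))

/-- Loads slot `j` of the vertex in variable `1` into variable `10 + j`. -/
def loadSlot (j : ℕ) : Cmd := .setVar (10 + j) (.get 5 (slot (.var 1) (.lit j)))

/-- Loads all slots of the vertex in variable `1`. -/
def loadSlots : Cmd :=
  .seq (loadSlot 0) (.seq (loadSlot 1) (.seq (loadSlot 2) (.seq (loadSlot 3) (loadSlot 4))))

/-- The difference of a coordinate of the vertices in the variables `a` and `1`. -/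
def coordDiff (c a : ℕ) : RExpr := .sub (.get c (.var a)) (.get c (.var 1))

/-- The test whether the vertices in the variables `a` and `b` are seen at a non-obtuse angle from
the vertex in variable `1`. -/
def nonObtuse (a b : ℕ) : BExpr :=
  .leR (.lit 0) (.add (.mul (coordDiff 0 a) (coordDiff 0 b)) (.mul (coordDiff 1 a) (coordDiff 1 b)))

/-- Pairs the vertices in the variables `a` and `b`. -/
def pairCmd (a b : ℕ) : Cmd :=
  .branch (.eqN (.var a) (.get 7 (.var 1))) (.setNat 9 (.var 1) (.var b))
    (.branch (.eqN (.var b) (.get 7 (.var 1))) (.setNat 9 (.var 1) (.var a))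
      (.setNat 10 (.var a) (.var b)))

/-- The possible pairs of four neighbours. -/
def slotPairs : List (Fin 4 × Fin 4) :=
  ((List.finRange 4).product (List.finRange 4)).filter fun q => q.1 ≠ q.2

/-- The possible pairs of disjoint pairs of five neighbours. -/
def slotQuadruples : List ((Fin 5 × Fin 5) × (Fin 5 × Fin 5)) :=
  (((List.finRange 5).product (List.finRange 5)).product
    ((List.finRange 5).product (List.finRange 5))).filter
      fun q => [q.1.1, q.1.2, q.2.1, q.2.2].Nodup

/-- The cases at a vertex of degree four. -/
def casesFour : List (BExpr × Cmd) :=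
  slotPairs.map fun q => (nonObtuse (10 + q.1) (10 + q.2), pairCmd (10 + q.1) (10 + q.2))

/-- The cases at a vertex of degree five. -/
def casesFive : List (BExpr × Cmd) :=
  slotQuadruples.map fun q =>
    (.and (nonObtuse (10 + q.1.1) (10 + q.1.2)) (nonObtuse (10 + q.2.1) (10 + q.2.2)),
      .seq (pairCmd (10 + q.1.1) (10 + q.1.2)) (pairCmd (10 + q.2.1) (10 + q.2.2)))

/-- Lowers the degree of the vertex in variable `1`. -/
def improve : Cmd :=
  .seq loadSlots (.branch (.eqN (.get 4 (.var 1)) (.lit 4)) (firstMatch casesFour)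
    (.branch (.eqN (.get 4 (.var 1)) (.lit 5)) (firstMatch casesFive) .skip))

/-- Writes one edge of the new tree. -/
def writeEdge : Cmd :=
  .seq (.setVar 4 (.get 8 (.add (.var 1) (.lit 1))))
    (.branch (.eqN (.get 10 (.var 4)) (.get 7 (.var 4)))
      (.seq (.setNat 2 (.var 1) (.get 7 (.var 4))) (.setNat 3 (.var 1) (.get 9 (.var 4))))
      (.seq (.setNat 2 (.var 1) (.var 4)) (.setNat 3 (.var 1) (.get 10 (.var 4)))))

/-- The linear-time program. -/
def program : Cmd :=
  .branch (.ltN (.lit 1) (.var 0))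
    (.seq readEdges (.seq findLeaf (.seq search (.seq (forLoop (.var 0) initChoice)
      (.seq (forLoop (.var 0) improve) (forLoop (.sub (.var 0) (.lit 1)) writeEdge)))))) .skip

variable {n : ℕ} {T : SimpleGraph (Fin n)} {p : Fin n → GeomTree.Plane}
  {N : Fin n → List (Fin n)} {r : Fin n} {Q : List (Fin n)} {s : Store} {par : Fin n → Fin n}
  {σ : (Fin n → Fin n) × (Fin n → Fin n)}

/-- The memory holds the parents `par`, the order `Q` and the choices `σ`. -/
structure ChoiceState (p : Fin n → GeomTree.Plane) (N : Fin n → List (Fin n)) (Q : List (Fin n))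
    (par : Fin n → Fin n) (σ : (Fin n → Fin n) × (Fin n → Fin n)) (s : Store) : Prop where
  read : ReadState p N s
  queue : ∀ j (hj : j < Q.length), s.nat 8 j = (Q[j] : ℕ)
  parent : ∀ y : Fin n, s.nat 7 y = par y
  top : ∀ y : Fin n, s.nat 9 y = σ.1 y
  up : ∀ y : Fin n, s.nat 10 y = σ.2 y

theorem ChoiceState.congr {s' : Store} (h : ChoiceState p N Q par σ s) (h0 : s'.var 0 = s.var 0)
    (hr : s'.real = s.real) (hn : ∀ a ∈ [4, 5, 7, 8, 9, 10], s'.nat a = s.nat a) :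
    ChoiceState p N Q par σ s' where
  read := h.read.congr h0 hr (hn 4 (by simp)) (hn 5 (by simp))
  queue := by rw [hn 8 (by simp)]; exact h.queue
  parent := by rw [hn 7 (by simp)]; exact h.parent
  top := by rw [hn 9 (by simp)]; exact h.top
  up := by rw [hn 10 (by simp)]; exact h.up

theorem runs_initChoice (hs : ReadState p N s) (hQ : ∀ j (hj : j < Q.length), s.nat 8 j = (Q[j] : ℕ))
    (hpar : ∀ y : Fin n, s.nat 7 y = par y) :
    Runs (forLoop (.var 0) initChoice) s ((n + 1) * forLoopCost (.var 0) initChoice)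
      (ChoiceState p N Q par (id, par)) := by
  have key := runs_forLoop (e := .var 0) (c := initChoice) (by simp [initChoice, Cmd.LoopFree])
    (N := n) (s := s)
    (fun k s => ReadState p N s ∧ (∀ j (hj : j < Q.length), s.nat 8 j = (Q[j] : ℕ)) ∧
      (∀ y : Fin n, s.nat 7 y = par y) ∧
      ∀ y : Fin n, (y : ℕ) < k → s.nat 9 y = y ∧ s.nat 10 y = par y)
    (fun k s h => h.1.size) ?_ ?_
  · obtain ⟨s', u, h1, h2, h3, h4, h5, h6⟩ := key
    exact ⟨s', u, h1, h2, h3, h4, h5, fun y => (h6 y y.2).1, fun y => (h6 y y.2).2⟩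
  · rintro k s hk ⟨hs, hQ, hpar, hc⟩ hvar
    have hpk := hpar ⟨k, hk⟩
    simp only at hpk
    refine ⟨by simp [initChoice, Cmd.run, Store.updNat, hvar], hs.congr ?_ ?_ ?_ ?_, ?_, ?_, ?_⟩
    all_goals simp only [initChoice, Cmd.run, Store.updNat, Store.updVar, NExpr.eval, hvar]
    · simp
    · simp
    · simp
    · simpa using hQ
    · simpa using hpar
    · intro y hy
      by_cases hyk : (y : ℕ) = k
      · simp [← hyk, hpar]
      · have := hc y (by omega)
        simpa [hyk] using this
  · exact ⟨hs.congr (by simp [Store.updVar]) rfl rfl rfl, hQ, hpar, fun y hy => absurd hy (by omega)⟩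

theorem ChoiceState.pairCmd (h : ChoiceState p N Q par σ s) {v x y : Fin n} {a b : ℕ}
    (hv : s.var 1 = v) (ha : s.var a = x) (hb : s.var b = y) :
    ChoiceState p N Q par (GeomTree.pairUp par v x y σ) ((pairCmd a b).run s) ∧
      ((RealRAM.pairCmd a b).run s).var = s.var := by
  have hp := h.parent v
  have cmp : ∀ z : Fin n, (z : ℕ) = par v ↔ z = par v := fun z => Fin.ext_iff.symm
  simp only [RealRAM.pairCmd, Cmd.run, BExpr.Holds, NExpr.eval, hv, ha, hb, hp, GeomTree.pairUp, cmp]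
  -- Transfers an update of a stored array to one on `Fin n`, with the classical decidability
  -- instance that occurs in `pairUp`.
  have hupd : ∀ (f : ℕ → ℕ) (g : Fin n → Fin n) (i j : Fin n), (∀ z : Fin n, f z = g z) →
      ∀ z : Fin n, Function.update f (i : ℕ) (j : ℕ) z =
        (@Function.update (Fin n) (fun _ => Fin n) (fun a b => Classical.propDecidable (a = b))
          g i j z : Fin n) := by
    intro f g i j hfg z
    by_cases hz : z = i
    · subst hz; simp
    · have hz' : (z : ℕ) ≠ i := fun e => hz (Fin.ext e)
      simp [Function.update, hz, hz', hfg]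
  have htop := fun i j => hupd _ _ i j h.top
  have hup := fun i j => hupd _ _ i j h.up
  split_ifs with h1 h2
  · refine ⟨⟨h.read.congr rfl rfl ?_ ?_, ?_, ?_, ?_, ?_⟩, rfl⟩ <;> simp only [Store.updNat]
    · simp
    · simp
    · simpa using h.queue
    · simpa using h.parent
    · simpa using htop v y
    · simpa using h.up
  · refine ⟨⟨h.read.congr rfl rfl ?_ ?_, ?_, ?_, ?_, ?_⟩, rfl⟩ <;> simp only [Store.updNat]
    · simp
    · simp
    · simpa using h.queue
    · simpa using h.parent
    · simpa using htop v x
    · simpa using h.up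
  · refine ⟨⟨h.read.congr rfl rfl ?_ ?_, ?_, ?_, ?_, ?_⟩, rfl⟩ <;> simp only [Store.updNat]
    · simp
    · simp
    · simpa using h.queue
    · simpa using h.parent
    · simpa using h.top
    · simpa using hup x y

/-- The angle test is the sign of a polynomial in the coordinates, within reach of a machine without
square roots. -/
theorem ReadState.nonObtuse_iff (h : ReadState p N s) {v x y : Fin n} {a b : ℕ}
    (hv : s.var 1 = v) (ha : s.var a = x) (hb : s.var b = y) :
    (nonObtuse a b).Holds s ↔ 0 ≤ inner ℝ (p x - p v) (p y - p v) := by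
  simp [nonObtuse, coordDiff, BExpr.Holds, RExpr.eval, NExpr.eval, hv, ha, hb, h.xcoord, h.ycoord,
    GeomTree.inner_plane]

theorem pairCmd_loopFree (a b : ℕ) : (pairCmd a b).LoopFree := by
  simp [pairCmd, Cmd.LoopFree]

theorem improve_loopFree : improve.LoopFree := by
  refine ⟨by simp [loadSlots, loadSlot, Cmd.LoopFree], firstMatch_loopFree ?_,
    firstMatch_loopFree ?_, trivial⟩
  · intro bc hbc
    obtain ⟨q, -, rfl⟩ := List.mem_map.1 hbc
    exact pairCmd_loopFree _ _
  · intro bc hbc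
    obtain ⟨q, -, rfl⟩ := List.mem_map.1 hbc
    exact ⟨pairCmd_loopFree _ _, pairCmd_loopFree _ _⟩

theorem mem_slotPairs {i j : Fin 4} : (i, j) ∈ slotPairs ↔ i ≠ j := by
  simp [slotPairs, List.mem_filter, List.product]

theorem mem_slotQuadruples {i j k l : Fin 5} :
    ((i, j), (k, l)) ∈ slotQuadruples ↔ [i, j, k, l].Nodup := by
  simp [slotQuadruples, List.mem_filter, List.product]

/-- The program tries every pair, or every two disjoint pairs, of slots, a bounded number of cases.
Geometry ensures that some test succeeds, and any successful one is a valid step. -/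
theorem ChoiceState.improve (hT : GeomTree.IsMST p T) (hp : Function.Injective p)
    (hN : ∀ x y, y ∈ N x ↔ T.Adj x y) (hnd : ∀ x, (N x).Nodup)
    (hdeg : ∀ x, (N x).length = GeomTree.deg T x) (hd : ∀ x, GeomTree.deg T x ≤ 5)
    (h : ChoiceState p N Q par σ s) {v : Fin n} (hv : s.var 1 = v) :
    ∃ σ', GeomTree.PairingStep T par p v σ σ' ∧ ChoiceState p N Q par σ' (improve.run s) ∧
      (RealRAM.improve.run s).var 1 = v := by
  set s₁ := loadSlots.run s with hs₁
  have hnat : s₁.nat = s.nat := by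
    simp [hs₁, loadSlots, loadSlot, Cmd.run, Store.updVar]
  have hreal : s₁.real = s.real := by
    simp [hs₁, loadSlots, loadSlot, Cmd.run, Store.updVar]
  have hv₁ : s₁.var 1 = v := by
    simp [hs₁, loadSlots, loadSlot, Cmd.run, Store.updVar, hv]
  have h₁ : ChoiceState p N Q par σ s₁ := h.congr
    (by simp [hs₁, loadSlots, loadSlot, Cmd.run, Store.updVar]) hreal (fun a _ => by rw [hnat])
  have hslot : ∀ j, j < 5 → s₁.var (10 + j) = s.nat 5 (5 * v + j) := by
    intro j hj
    rcases (by omega : j = 0 ∨ j = 1 ∨ j = 2 ∨ j = 3 ∨ j = 4) with rfl | rfl | rfl | rfl | rfl <;>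
    simp [hs₁, loadSlots, loadSlot, Cmd.run, Store.updVar, eval_slot, NExpr.eval, hv]
  -- Variables loaded from slots beyond the degree are meaningless; only those below it are used.
  have hz : ∀ j (hj : j < (N v).length), s₁.var (10 + j) = ((N v)[j] : ℕ) := fun j hj => by
    rw [hslot j (hj.trans_le ((hdeg v).trans_le (hd v))), (h.read.lists v).2 j hj]
  have hD : s₁.nat 4 v = GeomTree.deg T v := by rw [hnat, (h.read.lists v).1, hdeg]
  have hadj : ∀ j (hj : j < (N v).length), T.Adj v (N v)[j] := fun j hj =>
    (hN _ _).1 (List.getElem_mem hj)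
  have hrun : RealRAM.improve.run s = if GeomTree.deg T v = 4 then (firstMatch casesFour).run s₁
      else if GeomTree.deg T v = 5 then (firstMatch casesFive).run s₁ else s₁ := by
    simp only [RealRAM.improve, Cmd.run, ← hs₁, BExpr.Holds, NExpr.eval, hv₁, hD]
  rw [hrun]
  split_ifs with h4 h5
  · have hlen : (N v).length = 4 := (hdeg v).trans h4
    set z : Fin 4 → Fin n := fun i => (N v)[(i : ℕ)] with hzdef
    have hzi : Function.Injective z := fun i j hij =>
      Fin.ext ((List.Nodup.getElem_inj_iff (hnd v)).1 hij)
    have hzv : ∀ i : Fin 4, s₁.var (10 + i) = z i := fun i => hz i _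
    obtain ⟨bc, hbc, hb, hr⟩ := run_firstMatch (l := casesFour) (s := s₁) (by
      obtain ⟨i, j, hij, hin⟩ := GeomTree.exists_pair fun i => p (z i) - p v
      exact ⟨_, List.mem_map.2 ⟨(i, j), mem_slotPairs.2 hij, rfl⟩,
        (h₁.read.nonObtuse_iff hv₁ (hzv i) (hzv j)).2 hin⟩)
    obtain ⟨⟨i, j⟩, hij, rfl⟩ := List.mem_map.1 hbc
    rw [hr]
    obtain ⟨k1, k2⟩ := h₁.pairCmd hv₁ (hzv i) (hzv j)
    exact ⟨_, Or.inr (Or.inl ⟨h4, z i, z j, hadj _ _, hadj _ _, hzi.ne (mem_slotPairs.1 hij),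
      (h₁.read.nonObtuse_iff hv₁ (hzv i) (hzv j)).1 hb, rfl⟩), k1, by rw [k2]; exact hv₁⟩
  · have hlen : (N v).length = 5 := (hdeg v).trans h5
    set z : Fin 5 → Fin n := fun i => (N v)[(i : ℕ)] with hzdef
    have hzi : Function.Injective z := fun i j hij =>
      Fin.ext ((List.Nodup.getElem_inj_iff (hnd v)).1 hij)
    have hzv : ∀ i : Fin 5, s₁.var (10 + i) = z i := fun i => hz i _
    have hza : ∀ i, T.Adj v (z i) := fun i => hadj _ _
    obtain ⟨bc, hbc, hb, hr⟩ := run_firstMatch (l := casesFive) (s := s₁) (by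
      obtain ⟨i, j, k, l, hn, h1, h2⟩ := hT.exists_disjoint_pairs hp hzi hza
      exact ⟨_, List.mem_map.2 ⟨((i, j), (k, l)), mem_slotQuadruples.2 hn, rfl⟩,
        (h₁.read.nonObtuse_iff hv₁ (hzv i) (hzv j)).2 h1,
        (h₁.read.nonObtuse_iff hv₁ (hzv k) (hzv l)).2 h2⟩)
    obtain ⟨⟨⟨i, j⟩, ⟨k, l⟩⟩, hij, rfl⟩ := List.mem_map.1 hbc
    rw [hr]
    obtain ⟨k1, k2⟩ := h₁.pairCmd hv₁ (hzv i) (hzv j)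
    obtain ⟨k3, k4⟩ := k1.pairCmd (a := 10 + k) (b := 10 + l) (by rw [k2]; exact hv₁)
      (by rw [k2]; exact hzv k) (by rw [k2]; exact hzv l)
    refine ⟨_, Or.inr (Or.inr ⟨h5, z i, z j, z k, z l, by simp [hza],
      (mem_slotQuadruples.1 hij).map hzi, (h₁.read.nonObtuse_iff hv₁ (hzv i) (hzv j)).1 hb.1,
      (h₁.read.nonObtuse_iff hv₁ (hzv k) (hzv l)).1 hb.2, rfl⟩), k3, ?_⟩
    simp only [Cmd.run]
    rw [k4, k2]
    exact hv₁
  · have := hd v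
    exact ⟨σ, Or.inl ⟨by omega, rfl⟩, h₁, hv₁⟩

theorem runs_improve (hT : GeomTree.IsMST p T) (hp : Function.Injective p)
    (hN : ∀ x y, y ∈ N x ↔ T.Adj x y) (hnd : ∀ x, (N x).Nodup)
    (hdeg : ∀ x, (N x).length = GeomTree.deg T x) (hd : ∀ x, GeomTree.deg T x ≤ 5)
    {rank : Fin n → ℕ} (hr : GeomTree.IsRooting T r par rank) (hr1 : GeomTree.deg T r = 1)
    (h : ChoiceState p N Q par (id, par) s) :
    Runs (forLoop (.var 0) improve) s ((n + 1) * forLoopCost (.var 0) improve)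
      fun s => ∃ σ, ChoiceState p N Q par σ s ∧ GeomTree.Processed r par p Set.univ σ := by
  have key := runs_forLoop (e := .var 0) improve_loopFree (N := n) (s := s)
    (fun k s => ∃ σ, ChoiceState p N Q par σ s ∧
      GeomTree.Processed r par p {v | (v : ℕ) < k} σ)
    (fun k s h => by obtain ⟨σ, h, -⟩ := h; exact h.read.size) ?_ ?_
  · obtain ⟨s', u, h1, h2, σ, h3, h4⟩ := key
    refine ⟨s', u, h1, h2, σ, h3, ?_⟩
    rwa [show {v : Fin n | (v : ℕ) < n} = Set.univ from Set.eq_univ_of_forall fun v => v.2] at h4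
  · rintro k s hk ⟨σ, hσ, hproc⟩ hvar
    obtain ⟨σ', h1, h2, h3⟩ := hσ.improve hT hp hN hnd hdeg hd (v := ⟨k, hk⟩) hvar
    refine ⟨h3, σ', h2.congr (by simp [Store.updVar]) rfl (fun _ _ => rfl), ?_⟩
    have hset : {v : Fin n | (v : ℕ) < k + 1} = insert ⟨k, hk⟩ {v : Fin n | (v : ℕ) < k} := by
      ext v
      simp only [Set.mem_ofPred_eq, Set.mem_insert_iff, Fin.ext_iff]
      omega
    rw [hset]
    -- The loop also meets the root, but degree one leaves its choices unchanged, as `Processed`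
    -- requires there.
    by_cases hkr : (⟨k, hk⟩ : Fin n) = r
    · have hσσ : σ' = σ := by
        rw [hkr] at h1
        rcases h1 with ⟨-, h⟩ | ⟨h, -⟩ | ⟨h, -⟩
        · exact h
        · omega
        · omega
      rw [hσσ, hkr]
      exact ⟨fun v hv hvr => hproc.done v (hv.resolve_left hvr) hvr, fun v hv => hproc.todo v
        (hv.imp_left fun h4 h5 => h4 (Set.mem_insert_of_mem _ h5))⟩
    · exact hproc.step hr hT.1 hkr (by simp) h1
  · exact ⟨(id, par), h.congr (by simp [Store.updVar]) rfl (fun _ _ => rfl),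
      fun v hv => absurd hv (by simp), fun v _ => ⟨rfl, fun c hc => hc.2⟩⟩

/-- Cell `j` takes the edge of `Q[j + 1]`, because `Q[0]` is the root and has no edge to a parent.
-/
theorem runs_writeEdge (hQ : Q.length = n) (h : ChoiceState p N Q par σ s) :
    Runs (forLoop (.sub (.var 0) (.lit 1)) writeEdge) s
      ((n - 1 + 1) * forLoopCost (.sub (.var 0) (.lit 1)) writeEdge)
      fun s => ∀ j (hj : j + 1 < Q.length), s.nat 2 j = ((GeomTree.newEnds par σ Q[j + 1]).1 : ℕ) ∧
        s.nat 3 j = ((GeomTree.newEnds par σ Q[j + 1]).2 : ℕ) := by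
  have key := runs_forLoop (e := .sub (.var 0) (.lit 1)) (c := writeEdge)
    (by simp [writeEdge, Cmd.LoopFree]) (N := n - 1) (s := s)
    (fun k s => ChoiceState p N Q par σ s ∧ ∀ j (hj : j + 1 < Q.length), j < k →
      s.nat 2 j = ((GeomTree.newEnds par σ Q[j + 1]).1 : ℕ) ∧
        s.nat 3 j = ((GeomTree.newEnds par σ Q[j + 1]).2 : ℕ))
    (fun k s h => by simp [NExpr.eval, h.1.read.size]) ?_ ?_
  · obtain ⟨s', u, h1, h2, h3, h4⟩ := key
    exact ⟨s', u, h1, h2, fun j hj => h4 j hj (by omega)⟩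
  · rintro k s hk ⟨hs, hout⟩ hvar
    have hkQ : k + 1 < Q.length := by omega
    have e8 := hs.queue (k + 1) hkQ
    have e7 := hs.parent Q[k + 1]
    have e9 := hs.top Q[k + 1]
    have e10 := hs.up Q[k + 1]
    have cmp : ((σ.2 Q[k + 1] : Fin n) : ℕ) = par Q[k + 1] ↔ σ.2 Q[k + 1] = par Q[k + 1] :=
      Fin.ext_iff.symm
    have hrun : ∃ x y : ℕ, x = ((GeomTree.newEnds par σ Q[k + 1]).1 : ℕ) ∧
        y = ((GeomTree.newEnds par σ Q[k + 1]).2 : ℕ) ∧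
        writeEdge.run s = ((s.updVar 4 Q[k + 1]).updNat 2 k x).updNat 3 k y := by
      by_cases hup : σ.2 Q[k + 1] = par Q[k + 1]
      · refine ⟨_, _, rfl, rfl, ?_⟩
        simp [writeEdge, Cmd.run, BExpr.Holds, NExpr.eval, Store.updVar, Store.updNat, hvar, e7, e8,
          e9, e10, hup, GeomTree.newEnds]
      · refine ⟨_, _, rfl, rfl, ?_⟩
        simp [writeEdge, Cmd.run, BExpr.Holds, NExpr.eval, Store.updVar, Store.updNat, hvar, e7, e8,
          e10, hup, cmp, GeomTree.newEnds]
    obtain ⟨x, y, hx, hy, hrun⟩ := hrun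
    rw [hrun]
    refine ⟨by simp [Store.updVar, Store.updNat, hvar], hs.congr ?_ ?_ ?_, fun j hj hjk => ?_⟩
    · simp [Store.updVar, Store.updNat]
    · simp [Store.updVar, Store.updNat]
    · simp [Store.updVar, Store.updNat]
    · by_cases hjk' : j = k
      · subst hjk'
        simp [Store.updVar, Store.updNat, hx, hy]
      · have := hout j hj (by omega)
        simpa [Store.updVar, Store.updNat, hjk'] using this
  · exact ⟨h.congr (by simp [Store.updVar]) rfl (fun _ _ => rfl), fun j _ hj => absurd hj (by omega)⟩

/-- The list has `n - 1` entries and covers the `n - 1` edges of a tree, so no edge is repeated. -/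
theorem isEdgeList_newTree {rank : Fin n → ℕ} (hr : GeomTree.IsRooting T r par rank)
    (hs : GeomTree.Processed r par p Set.univ σ) {R : List (Fin n)} (hnd : (r :: R).Nodup)
    (hall : ∀ x, x ∈ r :: R) :
    IsEdgeList (GeomTree.newTree r par σ) (R.map (GeomTree.newEnds par σ)) := by
  classical
  have hR : ∀ x, x ∈ R ↔ x ≠ r := fun x =>
    ⟨fun h e => (List.nodup_cons.1 hnd).1 (e ▸ h), fun h => (List.mem_cons.1 (hall x)).resolve_left h⟩
  set L := (R.map (GeomTree.newEnds par σ)).map fun e => s(e.1, e.2) with hL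
  have hmem : ∀ e : Sym2 (Fin n), e ∈ L ↔ e ∈ (GeomTree.newTree r par σ).edgeSet := by
    intro e
    simp only [hL, List.map_map, List.mem_map, Function.comp_apply, hR]
    constructor
    · rintro ⟨x, hx, rfl⟩
      exact GeomTree.newTree_adj_newEnds hr hs hx
    · intro he
      induction e with | h u w =>
      obtain ⟨x, hx, ⟨rfl, rfl⟩ | ⟨rfl, rfl⟩⟩ := (GeomTree.newTree_adj hr hs).1 he
      · exact ⟨x, hx, rfl⟩
      · exact ⟨x, hx, Sym2.eq_swap⟩
  refine ⟨?_, hmem⟩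
  have hcard := (SimpleGraph.isTree_iff_connected_and_card.1 (GeomTree.newTree_isTree hr hs)).2
  have h1 : (GeomTree.newTree r par σ).edgeSet = ↑L.toFinset := by
    ext e; rw [← hmem, List.coe_toFinset]; rfl
  rw [Nat.card_coe_set_eq, h1, Set.ncard_coe_finset, Nat.card_fin] at hcard
  have h2 : L.length + 1 = n := by
    have := length_eq_of_mem hnd hall
    simpa [hL] using this
  exact Multiset.toFinset_card_eq_card_iff_nodup.1 (show L.toFinset.card = L.length by omega)

theorem runs_transform (hT : GeomTree.IsMST p T) (hp : Function.Injective p)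
    (hN : ∀ x y, y ∈ N x ↔ T.Adj x y) (hnd : ∀ x, (N x).Nodup)
    (hdeg : ∀ x, (N x).length = GeomTree.deg T x) (hd : ∀ x, GeomTree.deg T x ≤ 5)
    (hrdeg : GeomTree.deg T r = 1) (hQ : SearchState T r p N Q s) (hall : ∀ x, x ∈ Q) :
    Runs (.seq (forLoop (.var 0) initChoice)
      (.seq (forLoop (.var 0) improve) (forLoop (.sub (.var 0) (.lit 1)) writeEdge))) s
      ((n + 1) * forLoopCost (.var 0) initChoice + ((n + 1) * forLoopCost (.var 0) improve +
        (n - 1 + 1) * forLoopCost (.sub (.var 0) (.lit 1)) writeEdge))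
      fun s => ∃ T' : SimpleGraph (Fin n), Outputs s T' ∧ GeomTree.IsDegreeTree 4 T' ∧
        GeomTree.longestEdge p T' ≤ √2 * GeomTree.longestEdge p T := by
  set par : Fin n → Fin n := fun y => ⟨s.nat 7 y, hQ.parent_lt y⟩ with hpar
  have hroot : GeomTree.IsRooting T r par fun x => Q.idxOf x := by
    refine ⟨fun x hx => ?_, fun x hx => ?_⟩ <;>
    obtain ⟨z, -, hz, hadj, hlt⟩ := hQ.parent x (hall x) hx <;>
    have hpz : par x = z := Fin.ext hz <;>
    rw [hpz] <;> assumption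
  refine (runs_initChoice (par := par) hQ.read hQ.queue fun y => rfl).seq fun s hs =>
    (runs_improve hT hp hN hnd hdeg hd hroot hrdeg hs).seq fun s hs => ?_
  obtain ⟨σ, hσ, hproc⟩ := hs
  obtain ⟨s', u, k1, k2, k3⟩ := runs_writeEdge (length_eq_of_mem hQ.nodup hall) hσ
  refine ⟨s', u, k1, k2, GeomTree.newTree r par σ, ?_,
    GeomTree.newTree_isDegreeTree hroot hT.1 hproc hrdeg,
    GeomTree.longestEdge_newTree_le hroot hproc⟩
  obtain ⟨R, rfl⟩ := List.head?_eq_some_iff.1 hQ.head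
  refine ⟨_, isEdgeList_newTree hroot hproc hQ.nodup hall, fun j hj => ?_⟩
  have := k3 j (by simpa using hj)
  simpa using this

/-- The number of steps of the program on `n` points is at most `n` times this. -/
def programCost : ℕ :=
  forLoopCost (.sub (.var 0) (.lit 1)) readEdge +
    2 * forLoopCost (.var 0) (.branch (.eqN (.get 4 (.var 1)) (.lit 1)) (.setVar 3 (.var 1)) .skip) +
    2 * forLoopCost (.var 0) visitAll + 2 * forLoopCost (.var 0) initChoice +
    2 * forLoopCost (.var 0) improve + forLoopCost (.sub (.var 0) (.lit 1)) writeEdge + 30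

theorem exec_program (hT : GeomTree.IsMST p T) (hp : Function.Injective p)
    (hd : ∀ x, GeomTree.deg T x ≤ 5) {l : List (Fin n × Fin n)} (hl : IsEdgeList T l) :
    Runs program (inputStore p l) (programCost * n) fun s =>
      ∃ T' : SimpleGraph (Fin n), Outputs s T' ∧ GeomTree.IsDegreeTree 4 T' ∧
        ∀ B : SimpleGraph (Fin n), GeomTree.IsBST p B →
          GeomTree.longestEdge p T' ≤ √2 * GeomTree.longestEdge p B := by
  have hne := hT.1.connected.nonempty
  have hn : 0 < n := hne.elim fun x => x.pos
  have hvar : (inputStore p l).var 0 = n := by simp [inputStore]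
  by_cases h1 : 1 < n
  · have : Nontrivial (Fin n) := Fin.nontrivial_iff_two_le.2 h1
    obtain ⟨r₀, -, hr₀, -⟩ := GeomTree.exists_leaf hT.1
    have hN : ∀ x y, y ∈ neighborList l x ↔ T.Adj x y := fun x y => hl.mem_neighborList
    have hdeg := hl.length_neighborList
    have h5 : ∀ x, (neighborList l x).length ≤ 5 := fun x => (hdeg x).trans_le (hd x)
    have hpost : ∀ s : Store, (∃ T' : SimpleGraph (Fin n), Outputs s T' ∧
        GeomTree.IsDegreeTree 4 T' ∧
        GeomTree.longestEdge p T' ≤ √2 * GeomTree.longestEdge p T) →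
      ∃ T' : SimpleGraph (Fin n), Outputs s T' ∧ GeomTree.IsDegreeTree 4 T' ∧
        ∀ B : SimpleGraph (Fin n), GeomTree.IsBST p B →
          GeomTree.longestEdge p T' ≤ √2 * GeomTree.longestEdge p B := by
      rintro s ⟨T', k1, k2, k3⟩
      exact ⟨T', k1, k2, fun B hB => k3.trans (by
        gcongr; exact hT.longestEdge_le hB.1.connected)⟩
    have run := (runs_readEdges p hT.1 hd hl).seq fun s ⟨hs, h6, h7⟩ =>
      (runs_findLeaf hs ((hdeg r₀).trans hr₀)
        (Q := fun m => (∀ j, m 6 j = 0) ∧ ∀ j, m 7 j = 0) ⟨h6, h7⟩).seq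
        fun s ⟨hs, ⟨h6, h7⟩, r, hr, hr1⟩ =>
          (runs_search hT.1.connected hN h5 hs hr h6 h7).seq fun s ⟨Q, hQ, hall⟩ =>
            runs_transform hT hp hN hl.nodup_neighborList hdeg hd ((hdeg r).symm.trans hr1) hQ hall
    obtain ⟨s', u, k1, k2, k3⟩ := run
    refine ⟨s', _, .branchTrue ?_ k1, ?_, hpost s' k3⟩
    · simp [BExpr.Holds, NExpr.eval, hvar, h1]
    · simp only [programCost, BExpr.cost, NExpr.cost]
      -- Loops of `n - 1` rounds are charged `n` times, and loops of `n` rounds `n + 1 ≤ 2n` times;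
      -- hence the factors `2` in `programCost`.
      rw [Nat.sub_add_cancel hn] at k2
      generalize forLoopCost _ readEdge = a1 at *
      generalize forLoopCost _ (Cmd.branch _ _ _) = a2 at *
      generalize forLoopCost _ visitAll = a3 at *
      generalize forLoopCost _ initChoice = a4 at *
      generalize forLoopCost _ improve = a5 at *
      generalize forLoopCost _ writeEdge = a6 at *
      nlinarith
  -- On a single point the program stops at once, and the empty list is the correct output in any
  -- memory.
  · obtain rfl : n = 1 := by omega
    refine ⟨_, _, .branchFalse (by simp [BExpr.Holds, NExpr.eval, hvar]) (.skip _), ?_, ⊥,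
      ⟨[], ⟨by simp, by simp⟩, by simp⟩, ⟨?_, fun v => ?_⟩, fun B _ => ?_⟩
    · simp [BExpr.cost, NExpr.cost, programCost]
    · exact SimpleGraph.IsTree.of_subsingleton
    · rw [GeomTree.deg_eq_zero_of_subsingleton]; omega
    · simp [GeomTree.longestEdge_eq_zero]

end RealRAM

theorem mainTheorem2 :
    -- a degree-4 spanning tree within a factor `√2` of the bottleneck spanning tree
    (∀ P : Finset GeomTree.Plane, P.Nonempty →
      ∃ T : SimpleGraph P, GeomTree.IsDegreeTree 4 T ∧
        ∀ B : SimpleGraph P, GeomTree.IsBST (GeomTree.points P) B →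
          GeomTree.longestEdge (GeomTree.points P) T ≤
            √2 * GeomTree.longestEdge (GeomTree.points P) B) ∧
    -- the bound on `β₄`
    GeomTree.beta 4 ≤ ENNReal.ofReal (√2) ∧
    -- the transformation of a degree-5 minimum spanning tree rooted at a leaf `r` with child `v`
    (∀ (P : Finset GeomTree.Plane) (T : SimpleGraph P),
      GeomTree.IsMST (GeomTree.points P) T → (∀ x, GeomTree.deg T x ≤ 5) →
      ∀ r v : P, GeomTree.deg T r = 1 → T.Adj r v →
      ∃ T' : SimpleGraph P, GeomTree.IsDegreeTree 4 T' ∧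
        GeomTree.deg T' r = 1 ∧ GeomTree.deg T' v ≤ 3 ∧
        GeomTree.longestEdge (GeomTree.points P) T' ≤
          √2 * GeomTree.longestEdge (GeomTree.points P) T) ∧
    -- the linear-time algorithm, given a degree-5 minimum spanning tree
    (∃ (A : RealRAM.Cmd) (C : ℕ),
      ∀ (n : ℕ) (p : Fin n → GeomTree.Plane), Function.Injective p →
      ∀ T : SimpleGraph (Fin n), GeomTree.IsMST p T → (∀ x, GeomTree.deg T x ≤ 5) →
      ∀ l : List (Fin n × Fin n), RealRAM.IsEdgeList T l →
      ∃ (s : RealRAM.Store) (t : ℕ),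
        RealRAM.Exec A (RealRAM.inputStore p l) s t ∧ t ≤ C * n ∧
        ∃ T' : SimpleGraph (Fin n), RealRAM.Outputs s T' ∧ GeomTree.IsDegreeTree 4 T' ∧
          ∀ B : SimpleGraph (Fin n), GeomTree.IsBST p B →
            GeomTree.longestEdge p T' ≤ √2 * GeomTree.longestEdge p B) := by
  refine ⟨fun P hP => ?_, GeomTree.beta_four_le, fun P T hT hd r v hr hrv =>
    hT.exists_isDegreeTree (GeomTree.points_injective P) hd hr hrv,
    RealRAM.program, RealRAM.programCost, fun n p hp T hT hd l hl => ?_⟩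
  · have : Nonempty P := hP.to_subtype
    obtain ⟨T, h1, h2⟩ := GeomTree.exists_isDegreeTree_four (GeomTree.points_injective P)
    exact ⟨T, h1, fun B hB => h2 B hB.1.connected⟩
  · obtain ⟨s, t, h1, h2, h3⟩ := RealRAM.exec_program hT hp hd hl
    exact ⟨s, t, h1, h2, h3⟩
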